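/- **Setting.** Let $d,n\ge 1$, let $\mathcal Z$ be a set, and let $\ell_\theta(z)$, $\theta\in\mathbb R^d$, $z\in\mathcal Z$, be losses such that for every $z$ the map $\theta\mapsto\ell_\theta(z)$ is convex and twice continuously differentiable, with $\|\dot\ell_\theta(z)\|_2\le L_0$, $\|\ddot\ell_\theta(z)\|_{op}\le L_1$ and $\|\ddot\ell_\theta(z)-\ddot\ell_{\theta'}(z)\|_{op}\le L_2\|\theta-\theta'\|_2$ for all $\theta,\theta'$, where $L_0,L_1,L_2>0$. Fix $\lambda_{\rm reg}\ge0$ and $\theta_0\in\mathbb R^d$. For the empirical distribution $P_n$ of an (unordered) sample $z_1,\dots,z_n$ write $P_nf=\frac1n\sum_i f(z_i)$, let $\theta(P_n)$ be a minimizer over $\mathbb R^d$ of $P_n\ell_\theta+\frac{\lambda_{\rm reg}}2\|\theta-\theta_0\|_2^2$ whenever one exists (arbitrary otherwise), and let $\lambda_{\min}(P_n)$ be the smallest eigenvalue of $P_n\ddot\ell_{\theta(P_n)}$ (and $0$ if there is no minimizer). Two samples of size $n$ are neighboring if they differ in at most one observation. A randomized mechanism $M$ is $(\varepsilon,\delta)$-differentially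 private if $\mathbb P(M(P_n)\in A)\le e^{\varepsilon}\,\mathbb P(M(P_n')\in A)+\delta$ for all neighboring $P_n,P_n'$ and all measurable $A$. With $\Phi$ the standard normal c.d.f., let $\sigma^2(\varepsilon,\delta)=\inf\{\sigma^2:\sigma>0,\ \Phi(-\sigma\varepsilon-\frac1{2\sigma})+\Phi(-\sigma\varepsilon+\frac1{2\sigma})\le\delta\}$, let $k(\varepsilon,\delta)=\frac1\varepsilon\log\frac1{2\delta}$, and let $$R(\lambda)=\max\Big\{\tfrac\lambda2\Big(1+\sqrt{1-\tfrac{8L_0L_2}{n\lambda^2}}\Big)-\tfrac{L_1}n,\ \lambda_{\rm reg}\Big\}$$ if $\lambda>0$ and $\lambda^2\ge 8L_0L_2/n$, and $R(\lambda)=\lambda_{\rm reg}$ otherwise. Write $R^N$ for the $N$-fold composition of $R$. **Algorithm** (privacy level $(\varepsilon,\delta)$). (i) Draw $\xi\sim\mathrm{Laplace}(1)$, put $\widehat N=\min\{N\in\mathbb N: R^N(\lambda_{\min}(P_n)+\lambda_{\rm reg})=\lambda_{\rm reg}\}+\frac{2}{\varepsilon}\xi$ and $\widehat\lambda=\sup\{\lambda\ge0: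 R^m(\lambda)=\lambda_{\rm reg}\}$, where $m=\lfloor[\widehat N-k(\varepsilon/2,\delta/2)]_+\rfloor$. (ii) If $\widehat\lambda\ge\max\{3L_1/n,\sqrt{12L_0L_2/n}\}$, set $W=\frac1{2L_2}\big[\widehat\lambda-\sqrt{\widehat\lambda^2-8L_0L_2/n}\big]$ and return $\widehat\theta=\theta(P_n)+\mathcal N\big(0,W^2\sigma^2(\varepsilon/2,\delta/2)I_d\big)$, the Gaussian noise being independent of $\xi$; otherwise return $\widehat\theta=\perp$. **Proposition.** For all $\varepsilon>0$ and $\delta\in(0,1)$ the output $\widehat\theta$ of the algorithm is $(\varepsilon,\delta)$-differentially private. Additionally, for every $K>0$ there is a constant $C=C(K)<\infty$, depending on nothing else, such that whenever $\max\{1,\varepsilon\}\le K\log\frac1\delta$, $\gamma\in(0,1)$, and $$\lambda_{\min}(P_n)\ge C\max\Big\{\frac{L_1}{n\varepsilon}\log\frac1\delta,\ \sqrt{\frac{L_0L_2}{n\varepsilon}\log\frac1\delta}\Big\},$$ then with probability at least $1-\delta-\gamma$ the algorithm does not return $\perp$ and $$\big\|\theta(P_n)-\widehat\theta\big\|_2\le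 C\,\frac{L_0}{n\varepsilon\,\lambda_{\min}(P_n)}\sqrt{\log\tfrac1\delta}\,\Big[\sqrt d+\sqrt{\log\tfrac1\gamma}\Big].$$ -/

import Mathlib

open MeasureTheory ProbabilityTheory

noncomputable section

namespace ParamRelease

/-- The parameter space `ℝ^d` with its Euclidean norm. -/
abbrev Param (d : ℕ) : Type := EuclideanSpace ℝ (Fin d)

/-! ### Empirical distributions and neighbours -/

/-- The empirical mean `P f = (1/n) ∑ f(z_i)`.  An empirical distribution `P` of `n` points is
identified with the unordered sample (multiset of size `n`) that it comes from. -/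
def empMean {Z V : Type*} [AddCommGroup V] [Module ℝ V] {n : ℕ} (P : Sym Z n) (f : Z → V) : V :=
  (n : ℝ)⁻¹ • ((P : Multiset Z).map f).sum

/-- Two samples of the same size are neighbouring if they differ in at most a single observation
(equivalently, their empirical distributions are within `1/n` in total variation). -/
def Neighboring {Z : Type*} {n : ℕ} (P P' : Sym Z n) : Prop :=
  ∃ (s : Multiset Z) (z z' : Z), (P : Multiset Z) = z ::ₘ s ∧ (P' : Multiset Z) = z' ::ₘ s

/-- `(ε, δ)`-differential privacy of the randomized mechanism that draws `ω` from the (data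
independent) law `noise` and releases `M P ω`. -/
def IsDP {Z Ω Y : Type*} [MeasurableSpace Ω] [MeasurableSpace Y] {n : ℕ}
    (noise : Measure Ω) (M : Sym Z n → Ω → Y) (ε δ : ℝ) : Prop :=
  ∀ P P' : Sym Z n, Neighboring P P' → ∀ A : Set Y, MeasurableSet A →
    noise {ω | M P ω ∈ A} ≤
      ENNReal.ofReal (Real.exp ε) * noise {ω | M P' ω ∈ A} + ENNReal.ofReal δ

/-! ### Losses and regularized M-estimators -/

/-- The Hessian of `f`, as an operator: the derivative of the gradient. -/
def hess {d : ℕ} (f : Param d → ℝ) (t : Param d) : Param d →L[ℝ] Param d :=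
  fderiv ℝ (gradient f) t

/-- Generic smooth convex losses: for every observation the loss is convex, twice continuously
differentiable, `L₀`-Lipschitz, with `L₁`-Lipschitz gradient and `L₂`-Lipschitz Hessian. -/
structure IsSmoothLoss {Z : Type*} {d : ℕ} (loss : Param d → Z → ℝ) (L₀ L₁ L₂ : ℝ) : Prop where
  convex : ∀ z, ConvexOn ℝ Set.univ (fun t => loss t z)
  contDiff : ∀ z, ContDiff ℝ 2 (fun t => loss t z)
  grad_le : ∀ z t, ‖gradient (fun u => loss u z) t‖ ≤ L₀
  hess_le : ∀ z t, ‖hess (fun u => loss u z) t‖ ≤ L₁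
  hess_lip : ∀ z t t',
    ‖hess (fun u => loss u z) t - hess (fun u => loss u z) t'‖ ≤ L₂ * ‖t - t'‖

/-- The regularized empirical objective `P ℓ_t + (reg/2) ‖t - t₀‖²`. -/
def objective {Z : Type*} {d n : ℕ} (loss : Param d → Z → ℝ) (reg : ℝ) (t₀ : Param d)
    (P : Sym Z n) (t : Param d) : ℝ :=
  empMean P (loss t) + reg / 2 * ‖t - t₀‖ ^ 2

/-- The objective has a minimizer over `ℝ^d`. -/
def HasMinimizer {Z : Type*} {d n : ℕ} (loss : Param d → Z → ℝ) (reg : ℝ) (t₀ : Param d)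
    (P : Sym Z n) : Prop :=
  ∃ t, IsMinOn (objective loss reg t₀ P) Set.univ t

/-- `θ` is the M-estimator: `θ P` is a minimizer of the objective whenever one exists. -/
def IsMEstimator {Z : Type*} {d n : ℕ} (loss : Param d → Z → ℝ) (reg : ℝ) (t₀ : Param d)
    (θ : Sym Z n → Param d) : Prop :=
  ∀ P, HasMinimizer loss reg t₀ P → IsMinOn (objective loss reg t₀ P) Set.univ (θ P)

/-- The smallest real eigenvalue of an operator. -/
def minEigenvalue {d : ℕ} (H : Param d →L[ℝ] Param d) : ℝ :=
  sInf {μ : ℝ | Module.End.HasEigenvalue (H : Param d →ₗ[ℝ] Param d) μ}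

open Classical in
/-- The smallest eigenvalue of the empirical Hessian `P ℓ̈_{θ(P)}` of the unregularized empirical
loss at the M-estimator; it is `0` by convention if there is no minimizer (this can only
happen when `reg = 0`). -/
def lamMin {Z : Type*} {d n : ℕ} (loss : Param d → Z → ℝ) (reg : ℝ) (t₀ : Param d)
    (θ : Sym Z n → Param d) (P : Sym Z n) : ℝ :=
  if HasMinimizer loss reg t₀ P then
    minEigenvalue (empMean P (fun z => hess (fun u => loss u z) (θ P)))
  else 0

/-! ### Noise -/

/-- The standard Laplace distribution, with density `exp (-|x|) / 2`. -/
def laplace : Measure ℝ :=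
  volume.withDensity (fun x => ENNReal.ofReal (Real.exp (-|x|) / 2))

/-- The standard normal c.d.f. -/
def Phi (x : ℝ) : ℝ := cdf (gaussianReal 0 1) x

/-- The `(ε, δ)`-variance
`inf {σ² | Φ(-σ ε - 1/(2σ)) + Φ(-σ ε + 1/(2σ)) ≤ δ}` of the Gaussian mechanism. -/
def privVar (ε δ : ℝ) : ℝ :=
  sInf {v : ℝ | ∃ σ : ℝ, 0 < σ ∧ v = σ ^ 2 ∧
    Phi (-σ * ε - 1 / (2 * σ)) + Phi (-σ * ε + 1 / (2 * σ)) ≤ δ}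

/-! ### Private lower bounds for a recursively stable statistic -/

/-- `k(ε, δ) = (1/ε) log (1/(2δ))`. -/
def cutoff (ε δ : ℝ) : ℝ := 1 / ε * Real.log (1 / (2 * δ))

/-- The least number of iterations of the recursion `R` that bring `l` down to the floor `b`. -/
def steps (R : ℝ → ℝ) (b l : ℝ) : ℕ := sInf {N : ℕ | R^[N] l = b}

/-- The private lower bound on the statistic with value `l` (generic recursion `R` with floor `b`):
with `ξ ∼ Laplace(1)` put `N̂ = steps R b l + ξ/ε` and release
`λ̂ = sup {x ≥ 0 | R^m x = b}`, where `m` is the integer part of `[N̂ - k(ε, δ)]₊`. -/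
def lamHat (R : ℝ → ℝ) (b ε δ l ξ : ℝ) : ℝ :=
  sSup {x : ℝ | 0 ≤ x ∧ R^[⌊((steps R b l : ℝ) + 1 / ε * ξ) - cutoff ε δ⌋₊] x = b}

/-- The recursion for generic smooth losses,
`R(l) = max {(l/2) (1 + √(1 - 8 L₀ L₂ / (n l²))) - L₁/n, reg}`; where the square root is not
defined the recursion drops to its floor `reg`. -/
def recursion (L₀ L₁ L₂ reg : ℝ) (n : ℕ) (l : ℝ) : ℝ :=
  if 8 * L₀ * L₂ / n ≤ l ^ 2 ∧ 0 < l then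
    max (l / 2 * (1 + √(1 - 8 * L₀ * L₂ / (n * l ^ 2))) - L₁ / n) reg
  else reg

/-! ### The parameter release algorithm -/

/-- The acceptance condition `l ≥ max {3 L₁ / n, √(12 L₀ L₂ / n)}`. -/
def LargeEnough (L₀ L₁ L₂ : ℝ) (n : ℕ) (l : ℝ) : Prop :=
  max (3 * L₁ / n) √(12 * L₀ * L₂ / n) ≤ l

/-- The bound `W = (l - √(l² - 8 L₀ L₂ / n)) / (2 L₂)` on the local sensitivity. -/
def sensBound (L₀ L₂ : ℝ) (n : ℕ) (l : ℝ) : ℝ :=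
  1 / (2 * L₂) * (l - √(l ^ 2 - 8 * L₀ * L₂ / n))

/-- The noise used by the algorithm: an independent pair of a standard Laplace variable and a
standard Gaussian vector in `ℝ^d`. -/
def noiseLaw (d : ℕ) : Measure (ℝ × Param d) :=
  laplace.prod (stdGaussian (Param d))

open Classical in
/-- Parameter release for generic smooth losses, with privacy level `(ε, δ)`, on the sample `P` with
noise `ω = (ξ, g)`.  First `λ̂` is computed with privacy `(ε/2, δ/2)` from the statistic
`lamMin + reg`; if it is large enough, `θ(P) + W σ(ε/2, δ/2) g` is returned (in the left summand),
and otherwise the symbol `⊥` (the right summand). -/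
def release {Z : Type*} {d n : ℕ} (loss : Param d → Z → ℝ) (L₀ L₁ L₂ reg : ℝ) (t₀ : Param d)
    (θ : Sym Z n → Param d) (ε δ : ℝ) (P : Sym Z n) (ω : ℝ × Param d) : Param d ⊕ Unit :=
  let l := lamHat (recursion L₀ L₁ L₂ reg n) reg (ε / 2) (δ / 2)
    (lamMin loss reg t₀ θ P + reg) ω.1
  if LargeEnough L₀ L₁ L₂ n l then
    Sum.inl (θ P + (sensBound L₀ L₂ n l * √(privVar (ε / 2) (δ / 2))) • ω.2)
  else Sum.inr ()

end ParamRelease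

end

/-! Write λ(P) for `lamMin + reg`. Everything rests on a local stability estimate. Replacing one
observation moves the gradient of the objective by at most 2L₀/n, while at distance r from θ(P) its
inner product with the outward displacement is at least λ(P)r² − L₂r³/2. Where the square root is
defined, W = `sensBound` at λ(P) is the smaller root of L₂W² − λ(P)W + 2L₀/n = 0. At distance W the
perturbed gradient therefore still points outwards, and convexity traps the new minimizer in that
ball. The smallest eigenvalue loses at most L₂W through the move and L₁/n through the replacement,
which is exactly one step of the recursion: R(λ(P)) ≤ λ(P') (`stability_of_hasMinimizer`,
`recursion_le_of_neighboring`).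

Privacy: R is monotone with floor `reg`, so the number of steps down to the floor differs by at most
one between neighbours (`steps_le_succ`), and Laplace noise makes this integer (ε/2)-private.
Outside an event of probability δ/2 the released count is zero or below the true step count, which
forces λ̂ ≤ λ(P) (`levelSup_le`). As W decreases in λ, its value at λ̂ then dominates the distance
between the two minimizers, and Gaussian noise of that scale is (ε/2, δ/2)-private given the count.
`prod_le_of_composition` joins the two stages.

Accuracy: outside an event of probability at most δ the count falls short by at most 4 log(1/δ)/ε +
1, so λ̂ is at least what remains of λ(P) after that many steps of R. Each step costs at most order
L₀L₂/(nλ) + L₁/n while the value stays above λ/2, and the eigenvalue hypothesis makes the total cost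
at most λ/2. The error bound multiplies W ≤ 4L₀/(nλ̂), the size of `privVar`, and a tail bound for
the norm of a Gaussian vector. -/

namespace ParamRelease

/-! ### Recursively stable statistics -/

/-- The largest nonnegative statistic that `m` iterations of `R` bring down to the floor `b`. -/
noncomputable def levelSup (R : ℝ → ℝ) (b : ℝ) (m : ℕ) : ℝ :=
  sSup {x : ℝ | 0 ≤ x ∧ R^[m] x = b}

section Recursion

variable {R : ℝ → ℝ} {b l l' : ℝ} {m : ℕ}

lemma iterate_steps (h : ∃ N, R^[N] l = b) : R^[steps R b l] l = b := Nat.sInf_mem h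

lemma iterate_eq_of_steps_le (hb : R b = b) (h : ∃ N, R^[N] l = b) (hm : steps R b l ≤ m) :
    R^[m] l = b := by
  obtain ⟨k, rfl⟩ := Nat.exists_eq_add_of_le' hm
  rw [Function.iterate_add_apply, iterate_steps h, Function.iterate_fixed hb]

lemma le_iterate (hR : Monotone R) (hb : R b = b) (hl : b ≤ l) (m : ℕ) : b ≤ R^[m] l := by
  calc b = R^[m] b := (Function.iterate_fixed hb m).symm
    _ ≤ R^[m] l := hR.iterate m hl

/-- One step brings `l` below `l'`, and monotone iteration keeps it there until the floor. For
neighbouring samples this is the unit sensitivity that Laplace noise has to hide. -/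
lemma steps_le_succ (hR : Monotone R) (hb : R b = b) (hge : ∀ x, b ≤ R x)
    (h : ∃ N, R^[N] l' = b) (hl : R l ≤ l') : steps R b l ≤ steps R b l' + 1 := by
  refine Nat.sInf_le ?_
  refine le_antisymm ?_ ?_
  · rw [Function.iterate_succ_apply]
    exact (hR.iterate _ hl).trans (iterate_steps h).le
  · rw [Function.iterate_succ_apply]
    exact le_iterate hR hb (hge l) _

/-- If some `x > l` reached the floor in `m` steps, so would `l`, against the minimality of `steps`.
The case `m = 0` is separate because the released count is truncated at zero; the level is then the
floor itself. -/
lemma levelSup_le (hR : Monotone R) (hb : R b = b) (hb0 : 0 ≤ b) (hl : b ≤ l)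
    (hm : m = 0 ∨ m < steps R b l) : levelSup R b m ≤ l := by
  refine csSup_le ⟨b, hb0, Function.iterate_fixed hb m⟩ ?_
  rintro x ⟨-, hx⟩
  rcases hm with rfl | hm
  · simp only [Function.iterate_zero, id_eq] at hx
    exact hx.trans_le hl
  · by_contra! hlt
    have : R^[m] l = b :=
      le_antisymm ((hR.iterate m hlt.le).trans hx.le) (le_iterate hR hb hl m)
    exact absurd (Nat.sInf_le this) (not_le.2 hm)

/-- The iterate is itself a member of the set whose supremum is taken: `m` further steps complete at
least `steps R b l` of them. Undercounting by `j` thus costs at most `j` steps of `R`. -/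
lemma iterate_le_levelSup (hR : Monotone R) (hb : R b = b) (hb0 : 0 ≤ b) (hl : b ≤ l)
    (hbdd : BddAbove {x : ℝ | 0 ≤ x ∧ R^[m] x = b}) (h : ∃ N, R^[N] l = b) {j : ℕ}
    (hj : steps R b l ≤ m + j) : R^[j] l ≤ levelSup R b m := by
  refine le_csSup hbdd ⟨hb0.trans (le_iterate hR hb hl j), ?_⟩
  rw [← Function.iterate_add_apply]
  exact iterate_eq_of_steps_le hb h hj

end Recursion

/-! ### The recursion for smooth losses -/

section SmoothRecursion

variable {L₀ L₁ L₂ reg l l' : ℝ} {n : ℕ}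

lemma mul_one_add_sqrt (hl : 0 < l) (hn : 0 < n) :
    l / 2 * (1 + √(1 - 8 * L₀ * L₂ / (n * l ^ 2))) = (l + √(l ^ 2 - 8 * L₀ * L₂ / n)) / 2 := by
  have h : l * √(1 - 8 * L₀ * L₂ / (n * l ^ 2)) = √(l ^ 2 - 8 * L₀ * L₂ / n) := by
    have hn' : (n : ℝ) ≠ 0 := by positivity
    have e : l ^ 2 - 8 * L₀ * L₂ / n = l ^ 2 * (1 - 8 * L₀ * L₂ / (n * l ^ 2)) := by
      field_simp
    rw [e, Real.sqrt_mul (sq_nonneg l), Real.sqrt_sq hl.le]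
  rw [← h]; ring

lemma recursion_of_le (hn : 0 < n) (hl : 0 < l) (hc : 8 * L₀ * L₂ / n ≤ l ^ 2) :
    recursion L₀ L₁ L₂ reg n l = max ((l + √(l ^ 2 - 8 * L₀ * L₂ / n)) / 2 - L₁ / n) reg := by
  rw [recursion, if_pos ⟨hc, hl⟩, mul_one_add_sqrt hl hn]

lemma reg_le_recursion (l : ℝ) : reg ≤ recursion L₀ L₁ L₂ reg n l := by
  rw [recursion]; split_ifs
  · exact le_max_right _ _
  · exact le_rfl

/-- The square root is at most `l`, so a step above the floor loses at least `L₁ / n`. This makes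
`reg` a fixed point and forces termination. -/
lemma recursion_le (hn : 0 < n) (h0 : 0 < L₀) (h2 : 0 < L₂) (l : ℝ) :
    recursion L₀ L₁ L₂ reg n l ≤ max (l - L₁ / n) reg := by
  by_cases h : 8 * L₀ * L₂ / n ≤ l ^ 2 ∧ 0 < l
  · rw [recursion_of_le hn h.2 h.1]
    refine max_le_max ?_ le_rfl
    have : √(l ^ 2 - 8 * L₀ * L₂ / n) ≤ l := by
      refine Real.sqrt_le_iff.2 ⟨h.2.le, ?_⟩
      have : 0 ≤ 8 * L₀ * L₂ / n := by positivity
      linarith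
    linarith
  · rw [recursion, if_neg h]; exact le_max_right _ _

lemma recursion_reg (hn : 0 < n) (h0 : 0 < L₀) (h1 : 0 < L₁) (h2 : 0 < L₂) :
    recursion L₀ L₁ L₂ reg n reg = reg := by
  refine le_antisymm ((recursion_le hn h0 h2 reg).trans ?_) (reg_le_recursion _)
  have : 0 < L₁ / n := by positivity
  exact max_le (by linarith) le_rfl

lemma recursion_mono (hn : 0 < n) : Monotone (recursion L₀ L₁ L₂ reg n) := by
  intro x y hxy
  by_cases h : 8 * L₀ * L₂ / n ≤ x ^ 2 ∧ 0 < x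
  · have hy : 0 < y := h.2.trans_le hxy
    have hsq : x ^ 2 ≤ y ^ 2 := pow_le_pow_left₀ h.2.le hxy 2
    rw [recursion_of_le hn h.2 h.1, recursion_of_le hn hy (h.1.trans hsq)]
    refine max_le_max ?_ le_rfl
    have : √(x ^ 2 - 8 * L₀ * L₂ / n) ≤ √(y ^ 2 - 8 * L₀ * L₂ / n) :=
      Real.sqrt_le_sqrt (by linarith)
    linarith
  · rw [recursion, if_neg h]; exact reg_le_recursion _

lemma exists_iterate_recursion_eq (hn : 0 < n) (h0 : 0 < L₀) (h1 : 0 < L₁) (h2 : 0 < L₂)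
    (hl : reg ≤ l) : ∃ N, (recursion L₀ L₁ L₂ reg n)^[N] l = reg := by
  have hpos : 0 < L₁ / n := by positivity
  have key : ∀ N : ℕ, (recursion L₀ L₁ L₂ reg n)^[N] l ≤ max (l - N * (L₁ / n)) reg := by
    intro N
    induction N with
    | zero => simp
    | succ N ih =>
      rw [Function.iterate_succ_apply']
      refine (recursion_mono hn ih).trans ((recursion_le hn h0 h2 _).trans ?_)
      refine max_le ?_ (le_max_right _ _)
      rcases le_total (l - N * (L₁ / n)) reg with h | h
      · rw [max_eq_right h]; exact le_max_of_le_right (by linarith)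
      · rw [max_eq_left h]; refine le_max_of_le_left ?_
        push_cast; linarith
  obtain ⟨N, hN⟩ := exists_nat_ge ((l - reg) / (L₁ / n))
  refine ⟨N, le_antisymm ((key N).trans (max_le ?_ le_rfl))
    (le_iterate (recursion_mono hn) (recursion_reg hn h0 h1 h2) hl N)⟩
  rw [div_le_iff₀ hpos] at hN
  linarith

/-- Needed because `sSup` of an unbounded set is the default value 0. For large `x` the recursion is
at least `x / 2 - L₁ / n`, so bounded values come from bounded arguments. -/
lemma bddAbove_iterate_recursion (hn : 0 < n) (m : ℕ)
    (B : ℝ) : BddAbove {x : ℝ | (recursion L₀ L₁ L₂ reg n)^[m] x ≤ B} := by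
  induction m generalizing B with
  | zero => exact ⟨B, fun x hx => by simpa using hx⟩
  | succ m ih =>
    obtain ⟨B', hB'⟩ := ih B
    refine ⟨max (max (2 * (B' + L₁ / n)) √(8 * L₀ * L₂ / n)) 0, fun x hx => ?_⟩
    have hx' : recursion L₀ L₁ L₂ reg n x ≤ B' := hB' (by simpa using hx)
    by_contra! hlt
    obtain ⟨h, hx0⟩ := max_lt_iff.1 hlt
    obtain ⟨hxB, hxs⟩ := max_lt_iff.1 h
    have hc : 8 * L₀ * L₂ / n ≤ x ^ 2 := (Real.sqrt_le_left hx0.le).1 hxs.le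
    rw [recursion_of_le hn hx0 hc] at hx'
    have h3 := (le_max_left _ _).trans hx'
    have := Real.sqrt_nonneg (x ^ 2 - 8 * L₀ * L₂ / n)
    linarith

lemma sub_div_le_sqrt {c : ℝ} (hc0 : 0 ≤ c) (hl : 0 < l) (hc : c ≤ l ^ 2) :
    l - c / l ≤ √(l ^ 2 - c) := by
  refine Real.le_sqrt_of_sq_le ?_
  have e : (l - c / l) ^ 2 = l ^ 2 - 2 * c + c * c / l ^ 2 := by field_simp; ring
  have : c * c / l ^ 2 ≤ c := by
    rw [div_le_iff₀ (by positivity)]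
    exact mul_le_mul_of_nonneg_left hc hc0
  rw [e]; linarith

/-- With c = 8L₀L₂/n, a step from `x` costs at most c/(2x) + L₁/n. As long as the accumulated cost
is at most `l / 2`, one has `x ≥ l / 2`, so the cost is at most c/l + L₁/n. The factor 4 in `hc`
keeps the square root defined down to `l / 2`. -/
lemma sub_mul_le_iterate_recursion (hn : 0 < n) (h0 : 0 < L₀) (h1 : 0 < L₁) (h2 : 0 < L₂)
    (hl : 0 < l) (hc : 4 * (8 * L₀ * L₂ / n) ≤ l ^ 2) (j : ℕ)
    (hj : j * (8 * L₀ * L₂ / n / l + L₁ / n) ≤ l / 2) :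
    l - j * (8 * L₀ * L₂ / n / l + L₁ / n) ≤ (recursion L₀ L₁ L₂ reg n)^[j] l := by
  induction j with
  | zero => simp
  | succ j ih =>
    set c := 8 * L₀ * L₂ / n with hcdef
    have hc0 : 0 < c := by positivity
    have hs : 0 ≤ c / l + L₁ / n := by positivity
    push_cast at hj ⊢
    have hj' : j * (c / l + L₁ / n) ≤ l / 2 := by linarith
    rw [Function.iterate_succ_apply']
    set x := l - j * (c / l + L₁ / n) with hx
    have hxl : l / 2 ≤ x := by linarith
    have hx0 : 0 < x := by linarith
    have hcx : c ≤ x ^ 2 := by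
      have := pow_le_pow_left₀ (by positivity) hxl 2
      linarith [show (l / 2) ^ 2 = l ^ 2 / 4 by ring]
    refine le_trans ?_ (recursion_mono hn (ih hj'))
    rw [recursion_of_le hn hx0 hcx]
    refine le_max_of_le_left ?_
    have h3 := sub_div_le_sqrt hc0.le hx0 hcx
    have h4 : c / x ≤ 2 * (c / l) := by
      rw [div_le_iff₀ hx0]
      calc c = 2 * (c / l) * (l / 2) := by field_simp
        _ ≤ _ := by gcongr
    rw [← hcdef]
    linarith

lemma le_levelSup_recursion (hn : 0 < n) (h0 : 0 < L₀) (h1 : 0 < L₁) (h2 : 0 < L₂)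
    (hreg : 0 ≤ reg) (hrl : reg ≤ l) {m j : ℕ}
    (hj : steps (recursion L₀ L₁ L₂ reg n) reg l ≤ m + j) :
    (recursion L₀ L₁ L₂ reg n)^[j] l ≤ levelSup (recursion L₀ L₁ L₂ reg n) reg m :=
  iterate_le_levelSup (recursion_mono hn) (recursion_reg hn h0 h1 h2) hreg hrl
    ((bddAbove_iterate_recursion hn m reg).mono fun _ hx => hx.2.le)
    (exists_iterate_recursion_eq hn h0 h1 h2 hrl) hj

end SmoothRecursion

/-! ### The sensitivity bound -/

section SensBound

variable {L₀ L₁ L₂ reg l l' : ℝ} {n : ℕ}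

lemma sqrt_eq_sub_sensBound (h2 : 0 < L₂) (l : ℝ) :
    √(l ^ 2 - 8 * L₀ * L₂ / n) = l - 2 * L₂ * sensBound L₀ L₂ n l := by
  rw [sensBound]; field_simp; ring

lemma sensBound_pos (hn : 0 < n) (h0 : 0 < L₀) (h2 : 0 < L₂) (hl : 0 < l) :
    0 < sensBound L₀ L₂ n l := by
  have : √(l ^ 2 - 8 * L₀ * L₂ / n) < l := by
    rw [Real.sqrt_lt' hl]
    have : 0 < 8 * L₀ * L₂ / n := by positivity
    linarith
  rw [sensBound]
  have : 0 < l - √(l ^ 2 - 8 * L₀ * L₂ / n) := by linarith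
  positivity

/-- This quadratic equation is the balance between curvature and gradient perturbation that makes W
the stability radius. -/
lemma sensBound_root (h2 : 0 < L₂) (hc : 8 * L₀ * L₂ / n ≤ l ^ 2) :
    l * sensBound L₀ L₂ n l = L₂ * sensBound L₀ L₂ n l ^ 2 + 2 * L₀ / n := by
  have h := Real.sq_sqrt (sub_nonneg.2 hc)
  rw [sqrt_eq_sub_sensBound h2] at h
  have e : 8 * L₀ * L₂ / n = 4 * L₂ * (2 * L₀ / n) := by ring
  rw [e] at h
  refine mul_left_cancel₀ (show 4 * L₂ ≠ 0 by positivity) ?_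
  linear_combination -h

lemma sensBound_le (hn : 0 < n) (h0 : 0 < L₀) (h2 : 0 < L₂) (hl : 0 < l)
    (hc : 8 * L₀ * L₂ / n ≤ l ^ 2) : sensBound L₀ L₂ n l ≤ 4 * L₀ / (n * l) := by
  have h := sub_div_le_sqrt (by positivity) hl hc
  rw [sqrt_eq_sub_sensBound h2] at h
  have e : 8 * L₀ * L₂ / n / l = 2 * L₂ * (4 * L₀ / (n * l)) := by field_simp; ring
  rw [e] at h
  exact le_of_mul_le_mul_left (by linarith) (show 0 < 2 * L₂ by positivity)

lemma sensBound_anti (h0 : 0 < L₀) (h2 : 0 < L₂) (hl : 0 < l)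
    (hc : 8 * L₀ * L₂ / n ≤ l ^ 2) (hll : l ≤ l') :
    sensBound L₀ L₂ n l' ≤ sensBound L₀ L₂ n l := by
  rw [sensBound, sensBound]
  refine mul_le_mul_of_nonneg_left ?_ (by positivity)
  set c := 8 * L₀ * L₂ / n
  have hc0 : 0 ≤ c := by positivity
  have ha := Real.sq_sqrt (sub_nonneg.2 hc)
  have hsq : l ^ 2 ≤ l' ^ 2 := pow_le_pow_left₀ hl.le hll 2
  have hb : √(l ^ 2 - c) ≤ l := Real.sqrt_le_iff.2 ⟨hl.le, by linarith⟩
  have h0' := Real.sqrt_nonneg (l ^ 2 - c)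
  -- The function √(l² − c) has slope at least one, since √(l² − c) ≤ l.
  suffices √(l ^ 2 - c) + (l' - l) ≤ √(l' ^ 2 - c) by linarith
  refine Real.le_sqrt_of_sq_le ?_
  nlinarith [mul_nonneg (sub_nonneg.2 hll) (sub_nonneg.2 hb)]

/-- In this form a step reads as the loss of curvature from moving the minimizer by W, plus that
from replacing one Hessian. -/
lemma recursion_eq_sensBound (hn : 0 < n) (h2 : 0 < L₂) (hl : 0 < l)
    (hc : 8 * L₀ * L₂ / n ≤ l ^ 2) :
    recursion L₀ L₁ L₂ reg n l = max (l - L₂ * sensBound L₀ L₂ n l - L₁ / n) reg := by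
  rw [recursion_of_le hn hl hc, sqrt_eq_sub_sensBound h2]
  congr 2; ring

lemma LargeEnough.pos (hn : 0 < n) (h1 : 0 < L₁) (h : LargeEnough L₀ L₁ L₂ n l) : 0 < l := by
  refine lt_of_lt_of_le ?_ ((le_max_left _ _).trans h)
  positivity

lemma LargeEnough.le_sq (hn : 0 < n) (h0 : 0 < L₀) (h1 : 0 < L₁) (h2 : 0 < L₂)
    (h : LargeEnough L₀ L₁ L₂ n l) : 8 * L₀ * L₂ / n ≤ l ^ 2 := by
  have h3 := (Real.sqrt_le_left (h.pos hn h1).le).1 ((le_max_right _ _).trans h)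
  refine le_trans ?_ h3
  gcongr; norm_num

end SensBound

/-! ### The Laplace distribution -/

lemma measurable_laplaceDensity :
    Measurable (fun x : ℝ => ENNReal.ofReal (Real.exp (-|x|) / 2)) := by fun_prop

lemma laplace_Ioi {t : ℝ} (ht : 0 ≤ t) :
    laplace (Set.Ioi t) = ENNReal.ofReal (Real.exp (-t) / 2) := by
  rw [laplace, withDensity_apply _ measurableSet_Ioi]
  have e : ∀ x ∈ Set.Ioi t, ENNReal.ofReal (Real.exp (-|x|) / 2)
      = ENNReal.ofReal (Real.exp (-x) / 2) := by
    intro x hx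
    rw [abs_of_pos (ht.trans_lt hx)]
  rw [setLIntegral_congr_fun measurableSet_Ioi e, ← ofReal_integral_eq_lintegral_ofReal]
  · rw [integral_div, integral_exp_neg_Ioi]
  · exact (integrableOn_exp_neg_Ioi t).div_const 2
  · exact Filter.Eventually.of_forall fun x => by positivity

lemma laplace_map_neg : laplace.map (fun x => -x) = laplace := by
  ext A hA
  rw [Measure.map_apply measurable_neg hA, laplace, withDensity_apply _ (measurable_neg hA),
    withDensity_apply _ hA]
  have := (Measure.measurePreserving_neg (volume : Measure ℝ)).setLIntegral_comp_preimage hA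
    measurable_laplaceDensity
  rw [← this]
  simp only [abs_neg]

lemma laplace_Iio {t : ℝ} (ht : t ≤ 0) :
    laplace (Set.Iio t) = ENNReal.ofReal (Real.exp t / 2) := by
  rw [← laplace_map_neg, Measure.map_apply measurable_neg measurableSet_Iio]
  have : (fun x : ℝ => -x) ⁻¹' Set.Iio t = Set.Ioi (-t) := by ext x; simp
  rw [this, laplace_Ioi (neg_nonneg.2 ht), neg_neg]

lemma laplace_singleton (t : ℝ) : laplace {t} = 0 :=
  withDensity_absolutelyContinuous _ _ (by simp)

lemma laplace_Ici {t : ℝ} (ht : 0 ≤ t) :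
    laplace (Set.Ici t) = ENNReal.ofReal (Real.exp (-t) / 2) := by
  rw [← laplace_Ioi ht]
  refine le_antisymm ?_ (measure_mono Set.Ioi_subset_Ici_self)
  rw [← Set.Ioi_insert, Set.insert_eq]
  exact (measure_union_le _ _).trans (by rw [laplace_singleton, zero_add])

instance isProbabilityMeasure_laplace : IsProbabilityMeasure laplace := by
  constructor
  rw [← Set.Iio_union_Ici (a := (0 : ℝ)), measure_union _ measurableSet_Ici,
    laplace_Iio le_rfl, laplace_Ici le_rfl, neg_zero, Real.exp_zero,
    ← ENNReal.ofReal_add (by norm_num) (by norm_num)]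
  · norm_num
  · exact Set.Iio_disjoint_Ici le_rfl

/-- By translation invariance of Lebesgue measure it suffices to compare densities, whose ratio is
at most exp |a| by the triangle inequality. -/
lemma laplace_preimage_add_le (a : ℝ) {A : Set ℝ} (hA : MeasurableSet A) :
    laplace ((fun x => x + a) ⁻¹' A) ≤ ENNReal.ofReal (Real.exp |a|) * laplace A := by
  rw [laplace, withDensity_apply _ (measurable_add_const a hA), withDensity_apply _ hA,
    ← (measurePreserving_add_right (volume : Measure ℝ) a).setLIntegral_comp_preimage hA
      measurable_laplaceDensity, ← lintegral_const_mul _ (by fun_prop)]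
  refine lintegral_mono fun x => ?_
  rw [← ENNReal.ofReal_mul (by positivity)]
  refine ENNReal.ofReal_le_ofReal ?_
  rw [← mul_div_assoc, ← Real.exp_add]
  have := abs_sub_abs_le_abs_sub (x + a) x
  rw [add_sub_cancel_left] at this
  gcongr
  linarith

/-! ### The Gaussian distribution -/

section Gaussian

variable {ι : Type*} [Fintype ι]

lemma ofReal_Phi (x : ℝ) : ENNReal.ofReal (Phi x) = gaussianReal 0 1 (Set.Iic x) :=
  ofReal_cdf _ _

lemma Phi_mono : Monotone Phi := monotone_cdf _

lemma Phi_nonneg (x : ℝ) : 0 ≤ Phi x := cdf_nonneg _ _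

lemma Phi_le_exp {x : ℝ} (hx : x ≤ 0) : Phi x ≤ Real.exp (-x ^ 2 / 2) := by
  have h := measure_le_le_exp_mul_mgf (μ := gaussianReal 0 1) (X := id) x hx
    (integrable_exp_mul_gaussianReal x)
  rw [mgf_id_gaussianReal] at h
  rw [Phi, cdf_eq_real]
  refine h.trans_eq ?_
  rw [← Real.exp_add]
  congr 1
  push_cast; ring

/-- By symmetry the two closed half-lines at 0 have equal mass, and together they cover the line. -/
lemma half_le_Phi {x : ℝ} (hx : 0 ≤ x) : 1 / 2 ≤ Phi x := by
  have h : gaussianReal 0 1 (Set.Iic (0 : ℝ)) = gaussianReal 0 1 (Set.Ici 0) := by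
    conv_lhs => rw [← neg_zero, ← gaussianReal_map_neg (μ := 0) (v := 1)]
    rw [Measure.map_apply measurable_neg measurableSet_Iic]
    congr 1
    ext x; simp
  have h2 : (1 : ENNReal) ≤ gaussianReal 0 1 (Set.Iic (0 : ℝ)) + gaussianReal 0 1 (Set.Ici 0) := by
    rw [← measure_univ (μ := gaussianReal 0 1), ← Set.Iic_union_Ici (a := (0 : ℝ))]
    exact measure_union_le _ _
  rw [← h, ← ofReal_Phi, ← ENNReal.ofReal_add (Phi_nonneg _) (Phi_nonneg _),
    ENNReal.one_le_ofReal] at h2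
  linarith [Phi_mono hx]

lemma gaussianReal_Iio_le {a δ : ℝ} (h : ∀ y < a, Phi y ≤ δ) :
    gaussianReal 0 1 (Set.Iio a) ≤ ENNReal.ofReal δ := by
  rw [← measure_cdf (gaussianReal 0 1),
    StieltjesFunction.measure_Iio _ (tendsto_cdf_atBot _), sub_zero]
  refine ENNReal.ofReal_le_ofReal ?_
  refine le_of_tendsto ((monotone_cdf (gaussianReal 0 1)).tendsto_leftLim a) ?_
  filter_upwards [self_mem_nhdsWithin] with y hy using h y hy

lemma inner_eq_sum (x y : EuclideanSpace ℝ ι) : inner ℝ x y = ∑ i, x i * y i := by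
  simp [PiLp.inner_apply, mul_comm]

lemma integrable_exp_inner_stdGaussian (u : EuclideanSpace ℝ ι) :
    Integrable (fun x => Real.exp (inner ℝ u x)) (stdGaussian (EuclideanSpace ℝ ι)) := by
  rw [← map_pi_eq_stdGaussian, integrable_map_measure (by fun_prop) (by fun_prop)]
  have : ((fun x => Real.exp (inner ℝ u x)) ∘ WithLp.toLp 2) =
      fun x : ι → ℝ => ∏ i, Real.exp (u i * x i) := by
    ext x
    simp [inner_eq_sum, Real.exp_sum]
  rw [this]
  exact Integrable.fintype_prod fun i => integrable_exp_mul_gaussianReal (u i)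

lemma integral_cexp_stdGaussian (z : ι → ℂ) :
    ∫ x, Complex.exp (∑ i, z i * (x i : ℂ)) ∂(stdGaussian (EuclideanSpace ℝ ι)) =
      Complex.exp (∑ i, z i ^ 2 / 2) := by
  rw [← map_pi_eq_stdGaussian, integral_map (by fun_prop)
    (Measurable.aestronglyMeasurable (by fun_prop))]
  simp_rw [Complex.exp_sum]
  rw [integral_fintype_prod_eq_prod (f := fun i (x : ℝ) => Complex.exp (z i * (x : ℂ)))]
  refine Finset.prod_congr rfl fun i _ => ?_
  have := complexMGF_id_gaussianReal (μ := 0) (v := 1) (z i)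
  simp only [complexMGF, id_eq] at this
  rw [this]; simp

lemma isFiniteMeasure_gaussianTilt (u : EuclideanSpace ℝ ι) :
    IsFiniteMeasure ((stdGaussian (EuclideanSpace ℝ ι)).withDensity
      fun x => ENNReal.ofReal (Real.exp (inner ℝ u x - ‖u‖ ^ 2 / 2))) := by
  refine isFiniteMeasure_withDensity_ofReal ?_
  simp_rw [Real.exp_sub]
  exact ((integrable_exp_inner_stdGaussian u).div_const _).hasFiniteIntegral

/-- The Cameron–Martin formula for the standard Gaussian. -/
lemma stdGaussian_map_add_const (u : EuclideanSpace ℝ ι) :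
    (stdGaussian (EuclideanSpace ℝ ι)).map (fun x => x + u) =
      (stdGaussian (EuclideanSpace ℝ ι)).withDensity
        fun x => ENNReal.ofReal (Real.exp (inner ℝ u x - ‖u‖ ^ 2 / 2)) := by
  have := isFiniteMeasure_gaussianTilt u
  have : IsProbabilityMeasure ((stdGaussian (EuclideanSpace ℝ ι)).map (fun x => x + u)) :=
    Measure.isProbabilityMeasure_map (by fun_prop)
  -- Both measures have characteristic function exp(i⟨u,t⟩ − ‖t‖²/2).
  refine Measure.ext_of_charFun (funext fun t => ?_)
  rw [charFun_apply, charFun_apply, integral_map (by fun_prop)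
    (Measurable.aestronglyMeasurable (by fun_prop)),
    integral_withDensity_eq_integral_toReal_smul (by fun_prop)
      (Filter.Eventually.of_forall fun _ => ENNReal.ofReal_lt_top)]
  have e1 : ∀ x : EuclideanSpace ℝ ι, Complex.exp (↑(inner ℝ (x + u) t) * Complex.I) =
      Complex.exp (↑(inner ℝ u t) * Complex.I) *
        Complex.exp (∑ i, (t i * Complex.I) * (x i : ℂ)) := by
    intro x
    rw [← Complex.exp_add, inner_add_left, inner_eq_sum x t]
    congr 1
    push_cast
    rw [add_mul, add_comm, Finset.sum_mul]
    congr 1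
    exact Finset.sum_congr rfl fun i _ => by ring
  have e2 : ∀ x : EuclideanSpace ℝ ι,
      (ENNReal.ofReal (Real.exp (inner ℝ u x - ‖u‖ ^ 2 / 2))).toReal •
        Complex.exp (↑(inner ℝ x t) * Complex.I) =
      Complex.exp (-(‖u‖ : ℂ) ^ 2 / 2) *
        Complex.exp (∑ i, (u i + t i * Complex.I) * (x i : ℂ)) := by
    intro x
    rw [ENNReal.toReal_ofReal (Real.exp_nonneg _), Complex.real_smul, Complex.ofReal_exp,
      ← Complex.exp_add, ← Complex.exp_add, inner_eq_sum x t, inner_eq_sum u x]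
    congr 1
    push_cast
    simp_rw [add_mul, Finset.sum_add_distrib, Finset.sum_mul]
    rw [Finset.sum_congr rfl fun i _ =>
      show (x i : ℂ) * t i * Complex.I = t i * Complex.I * x i by ring]
    ring
  simp_rw [e1, e2]
  rw [integral_const_mul, integral_const_mul, integral_cexp_stdGaussian,
    integral_cexp_stdGaussian, ← Complex.exp_add, ← Complex.exp_add]
  congr 1
  have hu : (‖u‖ : ℂ) ^ 2 = ∑ i, (u i : ℂ) ^ 2 := by
    rw [← Complex.ofReal_pow, EuclideanSpace.norm_sq_eq]
    push_cast
    exact Finset.sum_congr rfl fun i _ => by rw [← Complex.ofReal_pow]; simp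
  rw [hu, inner_eq_sum]
  push_cast
  rw [Finset.sum_mul, neg_div, Finset.sum_div, ← Finset.sum_neg_distrib,
    ← Finset.sum_add_distrib, ← Finset.sum_add_distrib]
  refine Finset.sum_congr rfl fun i _ => ?_
  ring

lemma stdGaussian_map_inner {w : EuclideanSpace ℝ ι} (hw : ‖w‖ = 1) :
    (stdGaussian (EuclideanSpace ℝ ι)).map (fun x => inner ℝ w x) = gaussianReal 0 1 := by
  have h := IsGaussian.map_eq_gaussianReal (μ := stdGaussian (EuclideanSpace ℝ ι))
    (innerSL ℝ w)
  rw [integral_strongDual_stdGaussian, variance_dual_stdGaussian, innerSL_apply_norm, hw] at h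
  simpa using h

/-- Privacy of the Gaussian mechanism, for a shift `v` of a standard Gaussian vector. -/
lemma stdGaussian_shift_le {ε δ s : ℝ} (hε : 0 < ε) (hs : 0 < s)
    (hδ : gaussianReal 0 1 (Set.Iio (1 / (2 * s) - s * ε)) ≤ ENNReal.ofReal δ)
    {v : EuclideanSpace ℝ ι} (hv : ‖v‖ * s ≤ 1) {B : Set (EuclideanSpace ℝ ι)}
    (hB : MeasurableSet B) :
    stdGaussian (EuclideanSpace ℝ ι) ((fun g => g + v) ⁻¹' B) ≤
      ENNReal.ofReal (Real.exp ε) * stdGaussian (EuclideanSpace ℝ ι) B + ENNReal.ofReal δ := by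
  set μ := stdGaussian (EuclideanSpace ℝ ι)
  -- `D` is where the log-density ratio, the privacy loss, exceeds ε. Off `D` the ratio is at most
  -- exp ε; the shifted mass of `D` is the δ term.
  set D : Set (EuclideanSpace ℝ ι) := {x | ε < inner ℝ v x - ‖v‖ ^ 2 / 2} with hD
  have hDm : MeasurableSet D := measurableSet_lt (by fun_prop) (by fun_prop)
  have hadd : Measurable fun g : EuclideanSpace ℝ ι => g + v := by fun_prop
  have h1 : μ.map (fun g => g + v) (B \ D) ≤ ENNReal.ofReal (Real.exp ε) * μ B := by
    rw [stdGaussian_map_add_const, withDensity_apply _ (hB.diff hDm)]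
    calc _ ≤ ∫⁻ _ in B \ D, ENNReal.ofReal (Real.exp ε) ∂μ := by
          refine setLIntegral_mono measurable_const fun x hx => ?_
          exact ENNReal.ofReal_le_ofReal (Real.exp_le_exp.2 (not_lt.1 hx.2))
      _ ≤ _ := by
          rw [setLIntegral_const]
          gcongr
          exact Set.sdiff_subset
  have h2 : μ.map (fun g => g + v) D ≤ ENNReal.ofReal δ := by
    rw [Measure.map_apply hadd hDm]
    rcases eq_or_ne v 0 with rfl | hv0
    · have : (fun g : EuclideanSpace ℝ ι => g + 0) ⁻¹' D = ∅ := by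
        ext g; simp [hD, hε.le]
      rw [this]; simp
    have hn : 0 < ‖v‖ := norm_pos_iff.2 hv0
    have hw : ‖-(‖v‖⁻¹ • v)‖ = 1 := by
      rw [norm_neg, norm_smul, norm_inv, norm_norm, inv_mul_cancel₀ hn.ne']
    -- Under the shift, membership in `D` bounds the standard normal variable −⟨v,g⟩/r by r/2 − ε/r
    -- with r = ‖v‖. This threshold increases with r, and r ≤ 1/s.
    refine le_trans ?_ hδ
    rw [← stdGaussian_map_inner hw, Measure.map_apply (by fun_prop) measurableSet_Iio]
    refine measure_mono fun g hg => ?_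
    simp only [hD, Set.mem_preimage, Set.mem_ofPred_eq, inner_add_right,
      real_inner_self_eq_norm_sq] at hg
    simp only [Set.mem_preimage, Set.mem_Iio, inner_neg_left, real_inner_smul_left]
    set a := inner ℝ v g
    set r := ‖v‖
    have hb : -(r⁻¹ * a) < r / 2 - ε / r := by
      have : r⁻¹ * (ε - r ^ 2 / 2) < r⁻¹ * a :=
        mul_lt_mul_of_pos_left (by linarith) (by positivity)
      have e : r⁻¹ * (ε - r ^ 2 / 2) = ε / r - r / 2 := by field_simp
      linarith
    refine hb.trans_le ?_
    have hr : r ≤ 1 / s := by rwa [le_div_iff₀ hs]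
    have hsr : s ≤ 1 / r := by rw [le_div_iff₀ hn]; linarith
    have e1 : 1 / (2 * s) = 1 / s / 2 := by field_simp
    have e2 : s * ε ≤ ε / r := by
      rw [div_eq_mul_one_div, mul_comm]; gcongr
    linarith
  calc μ ((fun g => g + v) ⁻¹' B) = μ.map (fun g => g + v) B := (Measure.map_apply hadd hB).symm
    _ ≤ μ.map (fun g => g + v) (B \ D ∪ D) := measure_mono (by simp)
    _ ≤ _ := (measure_union_le _ _).trans (add_le_add h1 h2)

/-! ### The variance of the Gaussian mechanism -/

lemma sq_mem_of_le {ε δ s t : ℝ} (hs : 0 < s) (ht : 0 ≤ t)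
    (hst : t ≤ s * ε - 1 / (2 * s)) (hδ : 2 * Real.exp (-t ^ 2 / 2) ≤ δ) :
    s ^ 2 ∈ {v : ℝ | ∃ σ : ℝ, 0 < σ ∧ v = σ ^ 2 ∧
      Phi (-σ * ε - 1 / (2 * σ)) + Phi (-σ * ε + 1 / (2 * σ)) ≤ δ} := by
  refine ⟨s, hs, rfl, ?_⟩
  have h0 : 0 < 1 / (2 * s) := by positivity
  have h1 : Phi (-s * ε - 1 / (2 * s)) ≤ Phi (-t) := Phi_mono (by linarith)
  have h2 : Phi (-s * ε + 1 / (2 * s)) ≤ Phi (-t) := Phi_mono (by linarith)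
  have h3 := Phi_le_exp (neg_nonpos.2 ht)
  rw [neg_sq] at h3
  linarith

lemma privVar_le_sq {ε δ s t : ℝ} (hs : 0 < s) (ht : 0 ≤ t)
    (hst : t ≤ s * ε - 1 / (2 * s)) (hδ : 2 * Real.exp (-t ^ 2 / 2) ≤ δ) :
    privVar ε δ ≤ s ^ 2 :=
  csInf_le ⟨0, by rintro v ⟨σ, -, rfl, -⟩; positivity⟩ (sq_mem_of_le hs ht hst hδ)

lemma privVar_set_nonempty {ε δ : ℝ} (hε : 0 < ε) (hδ : 0 < δ) :
    {v : ℝ | ∃ σ : ℝ, 0 < σ ∧ v = σ ^ 2 ∧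
      Phi (-σ * ε - 1 / (2 * σ)) + Phi (-σ * ε + 1 / (2 * σ)) ≤ δ}.Nonempty := by
  set a := |Real.log (δ / 2)| with ha
  set t := √(2 * a) with ht
  have ht0 : 0 ≤ t := Real.sqrt_nonneg _
  refine ⟨_, sq_mem_of_le (s := (t + 1) / ε + 1) (t := t) (by positivity) ht0 ?_ ?_⟩
  · have h1 : ((t + 1) / ε + 1) * ε = t + 1 + ε := by field_simp
    have h2 : 1 / (2 * ((t + 1) / ε + 1)) ≤ 1 := by
      rw [div_le_one (by positivity)]
      have : 0 ≤ (t + 1) / ε := by positivity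
      linarith
    linarith
  · have h1 : t ^ 2 = 2 * a := Real.sq_sqrt (by positivity)
    have h2 : Real.exp (-t ^ 2 / 2) ≤ δ / 2 := by
      rw [← Real.exp_log (show 0 < δ / 2 by positivity), Real.exp_le_exp]
      have := neg_abs_le (Real.log (δ / 2))
      linarith
    linarith

/-- If σ² < 1/(2ε), the second `Phi` has a nonnegative argument, hence a value of at least 1/2 > δ.
So every admissible variance is at least 1/(2ε). -/
lemma sqrt_privVar_pos {ε δ : ℝ} (hε : 0 < ε) (hδ : 0 < δ) (hδ' : δ < 1 / 2) :
    0 < √(privVar ε δ) := by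
  refine Real.sqrt_pos.2 (lt_of_lt_of_le (show 0 < 1 / (2 * ε) by positivity)
    (le_csInf (privVar_set_nonempty hε hδ) ?_))
  rintro v ⟨σ, hσ, rfl, h⟩
  by_contra! hlt
  have h0 : 0 ≤ -σ * ε + 1 / (2 * σ) := by
    rw [lt_div_iff₀ (by positivity)] at hlt
    have : σ * ε ≤ 1 / (2 * σ) := by rw [le_div_iff₀ (by positivity)]; linarith
    linarith
  have := half_le_Phi h0
  linarith [Phi_nonneg (-σ * ε - 1 / (2 * σ))]

/-- Attainment of the infimum is not needed: each `y` below the threshold is still below it for σ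
slightly larger, and an admissible σ lies under that one. Of the two `Phi` terms only the second is
used. -/
lemma gaussianReal_Iio_privVar_le {ε δ : ℝ} (hε : 0 < ε) (hδ : 0 < δ) (hδ' : δ < 1 / 2) :
    gaussianReal 0 1 (Set.Iio (1 / (2 * √(privVar ε δ)) - √(privVar ε δ) * ε)) ≤
      ENNReal.ofReal δ := by
  have hs := sqrt_privVar_pos hε hδ hδ'
  have hsq : √(privVar ε δ) ^ 2 = privVar ε δ := Real.sq_sqrt (Real.sqrt_pos.1 hs).le
  set s := √(privVar ε δ)
  refine gaussianReal_Iio_le fun y hy => ?_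
  have hcont : ContinuousAt (fun σ : ℝ => 1 / (2 * σ) - σ * ε) s := by
    have : 2 * s ≠ 0 := by positivity
    fun_prop (disch := assumption)
  have hev : ∀ᶠ σ in nhdsWithin s (Set.Ioi s), y < 1 / (2 * σ) - σ * ε :=
    (hcont.eventually (lt_mem_nhds hy)).filter_mono nhdsWithin_le_nhds
  obtain ⟨s', hs'y, hs'⟩ := (hev.and self_mem_nhdsWithin).exists
  have hlt : privVar ε δ < s' ^ 2 := by
    rw [← hsq]; exact pow_lt_pow_left₀ hs' hs.le two_ne_zero
  obtain ⟨v, ⟨σ, hσ, rfl, h⟩, hv⟩ := exists_lt_of_csInf_lt (privVar_set_nonempty hε hδ) hlt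
  have hσs : σ < s' := lt_of_pow_lt_pow_left₀ 2 (hs.trans hs').le hv
  have h1 : 1 / (2 * s') ≤ 1 / (2 * σ) := by gcongr
  have h2 : σ * ε ≤ s' * ε := by gcongr
  have := Phi_mono (show y ≤ -σ * ε + 1 / (2 * σ) by linarith)
  linarith [Phi_nonneg (-σ * ε - 1 / (2 * σ))]

/-- For `max 1 ε ≤ K log (1/δ)` the standard deviation is at most of order `√(log (1/δ)) / ε`. -/
lemma sqrt_privVar_half_le {K ε δ : ℝ} (hK : 0 < K) (hε : 0 < ε) (hδ : 0 < δ)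
    (h1 : 1 ≤ K * Real.log (1 / δ)) (h2 : ε ≤ K * Real.log (1 / δ)) :
    √(privVar (ε / 2) (δ / 2)) ≤
      (2 * √(2 + 4 * K) + K) * (√(Real.log (1 / δ)) / ε) := by
  set L := Real.log (1 / δ) with hL
  have hL0 : 0 < L := by by_contra! h; nlinarith
  set q := √L with hq
  have hq0 : 0 < q := Real.sqrt_pos.2 hL0
  have hqL : q ^ 2 = L := Real.sq_sqrt hL0.le
  -- Chosen so that exp(−(Tq)²/2) = δ exp(−2KL). As KL ≥ 1, the last factor is at most 1/4, which
  -- leaves 2 · δ/4 = δ/2.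
  set T := √(2 + 4 * K) with hT
  have hT2 : T ^ 2 = 2 + 4 * K := Real.sq_sqrt (by positivity)
  have hT1 : 1 ≤ T := by rw [hT, Real.one_le_sqrt]; linarith
  set S := 2 * T + K with hS
  have hS0 : 0 < S := by positivity
  have hs0 : 0 < S * (q / ε) := by positivity
  refine Real.sqrt_le_iff.2 ⟨hs0.le, privVar_le_sq (t := T * q) hs0 (by positivity) ?_ ?_⟩
  · have e1 : S * (q / ε) * (ε / 2) = S / 2 * q := by field_simp
    have e2 : 1 / (2 * (S * (q / ε))) ≤ K / (2 * S) * q := by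
      have : 1 / (2 * (S * (q / ε))) = ε / (2 * S * q) := by field_simp
      rw [this, div_le_iff₀ (by positivity)]
      calc ε ≤ K * L := h2
        _ = _ := by rw [← hqL]; field_simp
    have e3 : K / (2 * S) ≤ S / 2 - T := by
      rw [div_le_iff₀ (by positivity), hS]
      nlinarith
    rw [e1]
    nlinarith [mul_le_mul_of_nonneg_right e3 hq0.le]
  · have e1 : -(T * q) ^ 2 / 2 = -L - 2 * K * L := by
      rw [mul_pow, hT2, hqL]; ring
    have e2 : Real.exp (-L) = δ := by rw [hL, ← Real.log_inv, one_div, inv_inv, Real.exp_log hδ]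
    have e3 : Real.exp (-(2 * K * L)) ≤ 1 / 4 := by
      have h3 : Real.exp (-(2 * K * L)) ≤ Real.exp (-2) := Real.exp_le_exp.2 (by linarith)
      have h4 : Real.exp (-2) ≤ 1 / 4 := by
        rw [Real.exp_neg, one_div]
        refine inv_anti₀ (by norm_num) ?_
        have := Real.add_one_le_exp (1 : ℝ)
        have e : Real.exp 2 = Real.exp 1 * Real.exp 1 := by rw [← Real.exp_add]; norm_num
        rw [e]; nlinarith
      exact h3.trans h4
    rw [e1, sub_eq_add_neg, Real.exp_add, e2]
    nlinarith

/-! ### The norm of a Gaussian vector -/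

lemma exp_sq_div_four_gaussianReal :
    Integrable (fun x : ℝ => Real.exp (x ^ 2 / 4)) (gaussianReal 0 1) ∧
      ∫ x, Real.exp (x ^ 2 / 4) ∂(gaussianReal 0 1) = √2 := by
  have e : ∀ x : ℝ, gaussianPDFReal 0 1 x * Real.exp (x ^ 2 / 4) =
      (√(2 * Real.pi))⁻¹ * Real.exp (-(1 / 4) * x ^ 2) := by
    intro x
    rw [gaussianPDFReal]
    push_cast
    rw [mul_one, mul_assoc, ← Real.exp_add]
    congr 2
    ring
  constructor
  · rw [gaussianReal_of_var_ne_zero _ one_ne_zero]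
    have : gaussianPDF 0 1 = fun x => ENNReal.ofReal (gaussianPDFReal 0 1 x) := rfl
    rw [this, integrable_withDensity_iff (by fun_prop) (by simp)]
    have h := (integrable_exp_neg_mul_sq (show (0 : ℝ) < 1 / 4 by norm_num)).const_mul
      (√(2 * Real.pi))⁻¹
    refine h.congr (Filter.Eventually.of_forall fun x => ?_)
    simp only
    rw [ENNReal.toReal_ofReal (gaussianPDFReal_nonneg _ _ _), mul_comm (Real.exp (x ^ 2 / 4)), e]
  · rw [integral_gaussianReal_eq_integral_smul one_ne_zero]
    simp_rw [smul_eq_mul, e]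
    rw [integral_const_mul, integral_gaussian, ← Real.sqrt_inv, ← Real.sqrt_mul (by positivity)]
    congr 1
    field_simp
    norm_num

/-- Chernoff bound for ‖g‖² at exponent 1/4: the moment generating function is 2^(d/2) ≤ exp d, so
the level 4(d + log(1/γ)) is exceeded with probability at most γ. The square of the stated radius is
at least that level. -/
lemma stdGaussian_norm_tail {γ : ℝ} (hγ : 0 < γ) (hγ' : γ < 1) :
    stdGaussian (EuclideanSpace ℝ ι)
      {g | 2 * (√(Fintype.card ι) + √(Real.log (1 / γ))) < ‖g‖} ≤ ENNReal.ofReal γ := by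
  set μ := stdGaussian (EuclideanSpace ℝ ι) with hμ
  set d : ℝ := (Fintype.card ι : ℝ) with hd
  set L := Real.log (1 / γ) with hL
  have hL0 : 0 ≤ L := Real.log_nonneg (by rw [le_div_iff₀ hγ]; linarith)
  have hprod : ((fun g : EuclideanSpace ℝ ι => Real.exp (1 / 4 * ‖g‖ ^ 2)) ∘ WithLp.toLp 2) =
      fun x : ι → ℝ => ∏ i, Real.exp (x i ^ 2 / 4) := by
    ext x
    simp [EuclideanSpace.norm_sq_eq, ← Real.exp_sum, Finset.mul_sum, div_eq_inv_mul]
  have hint : Integrable (fun g => Real.exp (1 / 4 * ‖g‖ ^ 2)) μ := by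
    rw [hμ, ← map_pi_eq_stdGaussian, integrable_map_measure (by fun_prop) (by fun_prop), hprod]
    exact Integrable.fintype_prod fun i => exp_sq_div_four_gaussianReal.1
  have hmgf : mgf (fun g => ‖g‖ ^ 2) μ (1 / 4) = √2 ^ Fintype.card ι := by
    rw [mgf, hμ, ← map_pi_eq_stdGaussian, integral_map (by fun_prop) (by fun_prop)]
    change ∫ x, ((fun g : EuclideanSpace ℝ ι => Real.exp (1 / 4 * ‖g‖ ^ 2)) ∘ WithLp.toLp 2) x
      ∂_ = _
    rw [hprod, integral_fintype_prod_eq_prod (f := fun _ (x : ℝ) => Real.exp (x ^ 2 / 4)),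
      Finset.prod_const, exp_sq_div_four_gaussianReal.2, Finset.card_univ]
  have h := measure_ge_le_exp_mul_mgf (μ := μ) (4 * (d + L)) (show (0 : ℝ) ≤ 1 / 4 by norm_num) hint
  have hb : Real.exp (-(1 / 4) * (4 * (d + L))) * mgf (fun g => ‖g‖ ^ 2) μ (1 / 4) ≤ γ := by
    have h1 : √2 ≤ Real.exp 1 := by
      have h3 := Real.add_one_le_exp (1 : ℝ)
      have h4 : √2 ≤ 2 := Real.sqrt_le_iff.2 (by norm_num)
      linarith
    have h2 : √2 ^ Fintype.card ι ≤ Real.exp d := by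
      calc _ ≤ Real.exp 1 ^ Fintype.card ι := by gcongr
        _ = _ := by rw [← Real.exp_nat_mul, mul_one]
    have h3 : Real.exp (-L) = γ := by rw [hL, ← Real.log_inv, one_div, inv_inv, Real.exp_log hγ]
    rw [hmgf]
    calc _ ≤ Real.exp (-(1 / 4) * (4 * (d + L))) * Real.exp d := by gcongr
      _ = Real.exp (-L) := by rw [← Real.exp_add]; congr 1; ring
      _ = γ := h3
      _ ≤ γ := le_rfl
  rw [← ofReal_measureReal]
  refine ENNReal.ofReal_le_ofReal (le_trans ?_ (h.trans hb))
  refine measureReal_mono fun g hg => ?_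
  simp only [Set.mem_ofPred_eq] at hg ⊢
  have hd0 : 0 ≤ d := by positivity
  have h1 := Real.sqrt_nonneg d
  have h2 := Real.sqrt_nonneg L
  have h3 := pow_le_pow_left₀ (by positivity) hg.le 2
  have h4 := Real.sq_sqrt hd0
  have h5 := Real.sq_sqrt hL0
  nlinarith [mul_nonneg h1 h2]

end Gaussian

/-! ### Hessians of smooth functions -/

section Hessian

variable {d : ℕ} {f : Param d → ℝ}

lemma differentiable_gradient (hf : ContDiff ℝ 2 f) : Differentiable ℝ (gradient f) := by
  have h1 : Differentiable ℝ (fderiv ℝ f) :=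
    (hf.fderiv_right (m := 1) (by norm_num)).differentiable (by norm_num)
  rw [differentiable_euclidean]
  intro i
  have e : (fun t => (gradient f t).ofLp i) =
      fun t => fderiv ℝ f t (EuclideanSpace.single i 1) := by
    ext t
    rw [← inner_gradient_left, EuclideanSpace.inner_single_right]
    simp
  rw [e]
  fun_prop

lemma inner_hess (hf : ContDiff ℝ 2 f) (t v w : Param d) :
    inner ℝ (hess f t v) w = fderiv ℝ (fderiv ℝ f) t v w := by
  have h1 : Differentiable ℝ (fderiv ℝ f) :=
    (hf.fderiv_right (m := 1) (by norm_num)).differentiable (by norm_num)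
  have h2 : HasFDerivAt (gradient f) (hess f t) t := (differentiable_gradient hf t).hasFDerivAt
  have h3 := h2.inner ℝ (hasFDerivAt_const w t)
  have h4 : HasFDerivAt (fun s => fderiv ℝ f s w)
      ((ContinuousLinearMap.apply ℝ ℝ w).comp (fderiv ℝ (fderiv ℝ f) t)) t :=
    (ContinuousLinearMap.apply ℝ ℝ w).hasFDerivAt.comp t (h1 t).hasFDerivAt
  simp_rw [inner_gradient_left] at h3
  have := congrArg (fun A : Param d →L[ℝ] ℝ => A v) (h3.unique h4)
  simpa [fderivInnerCLM_apply] using this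

lemma inner_hess_comm (hf : ContDiff ℝ 2 f) (t v w : Param d) :
    inner ℝ (hess f t v) w = inner ℝ v (hess f t w) := by
  rw [real_inner_comm (hess f t w), inner_hess hf, inner_hess hf]
  exact (hf.contDiffAt.isSymmSndFDerivAt (by simp)) v w

lemma hasDerivAt_line (t v : Param d) (s : ℝ) : HasDerivAt (fun s : ℝ => t + s • v) v s := by
  simpa using ((hasDerivAt_id s).smul_const v).const_add t

lemma hasDerivAt_comp_line (hf : ContDiff ℝ 2 f) (t v : Param d) (s : ℝ) :
    HasDerivAt (fun s : ℝ => f (t + s • v)) (inner ℝ (gradient f (t + s • v)) v) s := by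
  rw [inner_gradient_left]
  exact ((hf.differentiable (by norm_num) _).hasFDerivAt).comp_hasDerivAt s (hasDerivAt_line t v s)

lemma hasDerivAt_inner_gradient_line (hf : ContDiff ℝ 2 f) (t v : Param d) (s : ℝ) :
    HasDerivAt (fun s : ℝ => inner ℝ (gradient f (t + s • v)) v)
      (inner ℝ (hess f (t + s • v) v) v) s := by
  have h := ((differentiable_gradient hf _).hasFDerivAt).comp_hasDerivAt s (hasDerivAt_line t v s)
  have h2 := h.inner ℝ (hasDerivAt_const s v)
  simp only [inner_zero_right, zero_add] at h2
  exact h2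

lemma ConvexOn.comp_line {f : Param d → ℝ} (hc : ConvexOn ℝ Set.univ f) (t v : Param d) :
    ConvexOn ℝ Set.univ (fun s : ℝ => f (t + s • v)) := by
  refine ⟨convex_univ, fun x _ y _ a b ha hb hab => ?_⟩
  have h := hc.2 (Set.mem_univ (t + x • v)) (Set.mem_univ (t + y • v)) ha hb hab
  have e : a • (t + x • v) + b • (t + y • v) = t + (a • x + b • y) • v := by
    rw [smul_add, smul_add, smul_smul, smul_smul, add_smul, smul_eq_mul, smul_eq_mul]
    nth_rewrite 3 [← one_smul ℝ t]
    rw [← hab, add_smul]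
    abel
  rwa [e] at h

/-- Restricted to a line, a convex function has a monotone derivative, whose own derivative is this
quadratic form. -/
lemma inner_hess_nonneg (hf : ContDiff ℝ 2 f) (hc : ConvexOn ℝ Set.univ f) (t v : Param d) :
    0 ≤ inner ℝ (hess f t v) v := by
  have hm := (ConvexOn.comp_line hc t v).monotoneOn_deriv
    fun s _ => (hasDerivAt_comp_line hf t v s).differentiableAt
  have e : deriv (fun s : ℝ => f (t + s • v)) = fun s => inner ℝ (gradient f (t + s • v)) v :=
    funext fun s => (hasDerivAt_comp_line hf t v s).deriv
  rw [e, monotoneOn_univ] at hm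
  have h := hm.deriv_nonneg (x := 0)
  rw [(hasDerivAt_inner_gradient_line hf t v 0).deriv] at h
  simpa using h

end Hessian

/-! ### Smallest eigenvalues -/

section Eigenvalue

variable {d : ℕ} {H : Param d →L[ℝ] Param d}

lemma inner_eq_of_hasEigenvalue {μ : ℝ}
    (h : Module.End.HasEigenvalue (H : Param d →ₗ[ℝ] Param d) μ) :
    ∃ v : Param d, v ≠ 0 ∧ inner ℝ (H v) v = μ * ‖v‖ ^ 2 := by
  obtain ⟨v, hv⟩ := h.exists_hasEigenvector
  refine ⟨v, hv.2, ?_⟩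
  have : H v = μ • v := hv.apply_eq_smul
  rw [this, real_inner_smul_left, real_inner_self_eq_norm_sq]

lemma le_of_hasEigenvalue {c μ : ℝ} (hc : ∀ v, c * ‖v‖ ^ 2 ≤ inner ℝ (H v) v)
    (h : Module.End.HasEigenvalue (H : Param d →ₗ[ℝ] Param d) μ) : c ≤ μ := by
  obtain ⟨v, hv, e⟩ := inner_eq_of_hasEigenvalue h
  have := hc v
  rw [e] at this
  have hn := norm_pos_iff.2 hv
  exact le_of_mul_le_mul_right this (by positivity)

lemma neg_norm_mul_le_inner (v : Param d) : -‖H‖ * ‖v‖ ^ 2 ≤ inner ℝ (H v) v := by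
  have h1 := neg_abs_le (inner ℝ (H v) v)
  have h2 := abs_real_inner_le_norm (H v) v
  have h3 := mul_le_mul_of_nonneg_right (H.le_opNorm v) (norm_nonneg v)
  linarith [show ‖H‖ * ‖v‖ * ‖v‖ = ‖H‖ * ‖v‖ ^ 2 by ring]

lemma hasEigenvalue_iInf_rayleigh (hd : 0 < d)
    (hH : ∀ v w, inner ℝ (H v) w = inner ℝ v (H w)) :
    Module.End.HasEigenvalue (H : Param d →ₗ[ℝ] Param d)
      (⨅ x : {x : Param d // x ≠ 0}, inner ℝ (H x) (x : Param d) / ‖(x : Param d)‖ ^ 2) := by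
  have : Nonempty (Fin d) := ⟨⟨0, hd⟩⟩
  have hs : (H : Param d →ₗ[ℝ] Param d).IsSymmetric := hH
  exact hs.hasEigenvalue_iInf_of_finiteDimensional

/-- Symmetry and `0 < d` provide an eigenvalue, so the infimum is not the default value of an empty
set. -/
lemma le_minEigenvalue (hd : 0 < d) (hH : ∀ v w, inner ℝ (H v) w = inner ℝ v (H w)) {c : ℝ}
    (hc : ∀ v, c * ‖v‖ ^ 2 ≤ inner ℝ (H v) v) : c ≤ minEigenvalue H :=
  le_csInf ⟨_, hasEigenvalue_iInf_rayleigh hd hH⟩ fun _ hμ => le_of_hasEigenvalue hc hμ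

lemma minEigenvalue_mul_le_inner (hd : 0 < d) (hH : ∀ v w, inner ℝ (H v) w = inner ℝ v (H w))
    (v : Param d) : minEigenvalue H * ‖v‖ ^ 2 ≤ inner ℝ (H v) v := by
  rcases eq_or_ne v 0 with rfl | hv
  · simp
  have hn := norm_pos_iff.2 hv
  have h1 : minEigenvalue H ≤
      ⨅ x : {x : Param d // x ≠ 0}, inner ℝ (H x) (x : Param d) / ‖(x : Param d)‖ ^ 2 :=
    csInf_le ⟨-‖H‖, fun _ hμ => le_of_hasEigenvalue neg_norm_mul_le_inner hμ⟩
      (hasEigenvalue_iInf_rayleigh hd hH)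
  have h2 : ⨅ x : {x : Param d // x ≠ 0}, inner ℝ (H x) (x : Param d) / ‖(x : Param d)‖ ^ 2 ≤
      inner ℝ (H v) v / ‖v‖ ^ 2 := by
    refine ciInf_le ⟨-‖H‖, ?_⟩ (⟨v, hv⟩ : {x : Param d // x ≠ 0})
    rintro _ ⟨x, rfl⟩
    have := norm_pos_iff.2 x.2
    simp only
    rw [le_div_iff₀ (by positivity)]
    exact neg_norm_mul_le_inner _
  rw [← le_div_iff₀ (by positivity)]
  exact h1.trans h2

end Eigenvalue

/-! ### Minimizers of convex functions -/

section Convex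

variable {d : ℕ} {F : Param d → ℝ} {G : Param d → Param d}

lemma add_inner_le_of_convexOn (hc : ConvexOn ℝ Set.univ F)
    (hG : ∀ t v, HasDerivAt (fun s : ℝ => F (t + s • v)) (inner ℝ (G t) v) 0) (t u : Param d) :
    F t + inner ℝ (G t) (u - t) ≤ F u := by
  have h := (ConvexOn.comp_line hc t (u - t)).le_slope_of_hasDerivAt (Set.mem_univ 0)
    (Set.mem_univ 1) zero_lt_one (hG t (u - t))
  rw [slope_def_field] at h
  simp only [one_smul, add_sub_cancel, zero_smul, add_zero, sub_zero, div_one] at h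
  linarith

lemma eq_zero_of_isMinOn
    (hG : ∀ t v, HasDerivAt (fun s : ℝ => F (t + s • v)) (inner ℝ (G t) v) 0) {t : Param d}
    (ht : IsMinOn F Set.univ t) : G t = 0 := by
  have hmin : IsLocalMin (fun s : ℝ => F (t + s • G t)) 0 := by
    refine Filter.Eventually.of_forall fun s => ?_
    simpa using ht (Set.mem_univ (t + s • G t))
  exact inner_self_eq_zero.1 (hmin.hasDerivAt_eq_zero (hG t (G t)))

/-- If the gradient of a convex function points outwards on a sphere, then the function has a
minimizer, and all its minimizers lie inside of that sphere. -/
lemma exists_isMinOn_of_inner_pos (hc : ConvexOn ℝ Set.univ F) (hF : Continuous F)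
    (hG : ∀ t v, HasDerivAt (fun s : ℝ => F (t + s • v)) (inner ℝ (G t) v) 0)
    {θ : Param d} {r : ℝ} (hr : 0 < r)
    (hpos : ∀ t, ‖t - θ‖ = r → 0 < inner ℝ (G t) (t - θ)) :
    (∃ t, IsMinOn F Set.univ t) ∧ ∀ t, IsMinOn F Set.univ t → ‖t - θ‖ ≤ r := by
  -- `p` is the radial projection of `t` to the sphere; the tangent inequality at `p` makes `F`
  -- strictly larger at `t`.
  have key : ∀ t, r < ‖t - θ‖ → ∃ p, ‖p - θ‖ = r ∧ F p < F t := by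
    intro t ht
    have hn : 0 < ‖t - θ‖ := hr.trans ht
    set a := r / ‖t - θ‖ with ha
    have ha0 : 0 < a := by positivity
    have ha1 : a < 1 := (div_lt_one hn).2 ht
    have hp : ‖θ + a • (t - θ) - θ‖ = r := by
      rw [add_sub_cancel_left, norm_smul, Real.norm_of_nonneg ha0.le, ha, div_mul_cancel₀ _ hn.ne']
    refine ⟨θ + a • (t - θ), hp, ?_⟩
    have h1 := add_inner_le_of_convexOn hc hG (θ + a • (t - θ)) t
    have h2 := hpos _ hp
    have e1 : t - (θ + a • (t - θ)) = (1 - a) • (t - θ) := by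
      rw [sub_smul, one_smul]; abel
    rw [add_sub_cancel_left, inner_smul_right] at h2
    rw [e1, inner_smul_right] at h1
    have h3 : 0 < inner ℝ (G (θ + a • (t - θ))) (t - θ) := pos_of_mul_pos_right h2 ha0.le
    have := mul_pos (sub_pos.2 ha1) h3
    linarith
  constructor
  · obtain ⟨t, -, ht⟩ := (isCompact_closedBall θ r).exists_isMinOn
      ⟨θ, Metric.mem_closedBall_self hr.le⟩ hF.continuousOn
    refine ⟨t, fun u _ => ?_⟩
    rcases le_or_gt ‖u - θ‖ r with hu | hu
    · exact ht (mem_closedBall_iff_norm.2 hu)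
    · obtain ⟨p, hp, hlt⟩ := key u hu
      exact (ht (mem_closedBall_iff_norm.2 hp.le)).trans hlt.le
  · intro t ht
    by_contra! hlt
    obtain ⟨p, -, hp⟩ := key t hlt
    exact absurd (ht (Set.mem_univ p)) (not_le.2 hp)

end Convex

/-! ### Empirical means -/

section EmpMean

variable {Z V W : Type*} [AddCommGroup V] [Module ℝ V] [AddCommGroup W] [Module ℝ W] {n : ℕ}

lemma map_empMean (A : V →ₗ[ℝ] W) (P : Sym Z n) (f : Z → V) :
    A (empMean P f) = empMean P (fun z => A (f z)) := by
  rw [empMean, empMean, map_smul, map_multiset_sum, Multiset.map_map]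
  rfl

lemma empMean_const (hn : 0 < n) (P : Sym Z n) (c : ℝ) : empMean P (fun _ => c) = c := by
  have : (n : ℝ) ≠ 0 := by positivity
  simp [empMean, this]

lemma empMean_add (P : Sym Z n) (f g : Z → V) :
    empMean P (fun z => f z + g z) = empMean P f + empMean P g := by
  simp [empMean, Multiset.sum_map_add]

lemma empMean_mono (P : Sym Z n) {f g : Z → ℝ} (h : ∀ z, f z ≤ g z) :
    empMean P f ≤ empMean P g :=
  mul_le_mul_of_nonneg_left (Multiset.sum_map_le_sum_map _ _ fun z _ => h z) (by positivity)

lemma empMean_nonneg (P : Sym Z n) {f : Z → ℝ} (h : ∀ z, 0 ≤ f z) : 0 ≤ empMean P f := by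
  refine le_trans ?_ (empMean_mono P h)
  simp [empMean]

lemma empMean_sub_empMean {P P' : Sym Z n} {s : Multiset Z} {z z' : Z}
    (hP : (P : Multiset Z) = z ::ₘ s) (hP' : (P' : Multiset Z) = z' ::ₘ s) (f : Z → V) :
    empMean P' f - empMean P f = (n : ℝ)⁻¹ • (f z' - f z) := by
  rw [empMean, empMean, hP, hP', ← smul_sub]
  simp

lemma hasDerivAt_empMean (P : Sym Z n) {f : Z → ℝ → ℝ} {f' : Z → ℝ} {x : ℝ}
    (h : ∀ z, HasDerivAt (f z) (f' z) x) :
    HasDerivAt (fun s => empMean P (fun z => f z s)) (empMean P f') x := by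
  have key : ∀ s : Multiset Z,
      HasDerivAt (fun u => (s.map (fun z => f z u)).sum) (s.map f').sum x := by
    intro s
    induction s using Multiset.induction with
    | empty => simpa using hasDerivAt_const x (0 : ℝ)
    | cons a s ih =>
      simp only [Multiset.map_cons, Multiset.sum_cons]
      exact (h a).add ih
  exact (key P).const_mul _

lemma continuous_empMean {X : Type*} [TopologicalSpace X] (P : Sym Z n) {f : Z → X → ℝ}
    (h : ∀ z, Continuous (f z)) : Continuous (fun x => empMean P (fun z => f z x)) :=
  continuous_const.mul (continuous_multiset_sum (P : Multiset Z) fun z _ => h z)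

lemma convexOn_empMean {d : ℕ} (P : Sym Z n) {f : Z → Param d → ℝ}
    (h : ∀ z, ConvexOn ℝ Set.univ (f z)) :
    ConvexOn ℝ Set.univ (fun x => empMean P (fun z => f z x)) := by
  have key : ∀ s : Multiset Z, ConvexOn ℝ Set.univ (fun x => (s.map (fun z => f z x)).sum) := by
    intro s
    induction s using Multiset.induction with
    | empty => simpa using convexOn_const (0 : ℝ) convex_univ
    | cons a s ih =>
      simp only [Multiset.map_cons, Multiset.sum_cons]
      exact (h a).add ih
  exact (key P).smul (by positivity)

lemma Neighboring.symm {P P' : Sym Z n} (h : Neighboring P P') : Neighboring P' P := by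
  obtain ⟨s, z, z', h, h'⟩ := h
  exact ⟨s, z', z, h', h⟩

end EmpMean

/-! ### Stability of regularized M-estimators -/

/-- The gradient of the empirical loss. -/
noncomputable def empGrad {Z : Type*} {d n : ℕ} (loss : Param d → Z → ℝ) (P : Sym Z n)
    (t : Param d) : Param d :=
  empMean P (fun z => gradient (fun u => loss u z) t)

/-- The Hessian of the empirical loss. -/
noncomputable def empHess {Z : Type*} {d n : ℕ} (loss : Param d → Z → ℝ) (P : Sym Z n)
    (t : Param d) : Param d →L[ℝ] Param d :=
  empMean P (fun z => hess (fun u => loss u z) t)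

section Stability

variable {Z : Type*} {d n : ℕ} {loss : Param d → Z → ℝ} {L₀ L₁ L₂ reg : ℝ} {t₀ : Param d}
  {θ : Sym Z n → Param d} {P P' : Sym Z n}

lemma inner_empGrad (P : Sym Z n) (t w : Param d) :
    inner ℝ (empGrad loss P t) w =
      empMean P (fun z => inner ℝ (gradient (fun u => loss u z) t) w) :=
  map_empMean
    { toFun := fun g : Param d => inner ℝ g w
      map_add' := fun _ _ => inner_add_left _ _ _
      map_smul' := fun _ _ => real_inner_smul_left _ _ _ } P _

lemma inner_empHess (P : Sym Z n) (t v w : Param d) :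
    inner ℝ (empHess loss P t v) w =
      empMean P (fun z => inner ℝ (hess (fun u => loss u z) t v) w) :=
  map_empMean
    { toFun := fun H : Param d →L[ℝ] Param d => inner ℝ (H v) w
      map_add' := fun _ _ => inner_add_left _ _ _
      map_smul' := fun _ _ => real_inner_smul_left _ _ _ } P _

lemma inner_empHess_comm (hℓ : IsSmoothLoss loss L₀ L₁ L₂) (P : Sym Z n) (t v w : Param d) :
    inner ℝ (empHess loss P t v) w = inner ℝ v (empHess loss P t w) := by
  rw [real_inner_comm (empHess loss P t w) v, inner_empHess, inner_empHess]
  congr 1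
  ext z
  rw [inner_hess_comm (hℓ.contDiff z), real_inner_comm]

lemma inner_empHess_nonneg (hℓ : IsSmoothLoss loss L₀ L₁ L₂) (P : Sym Z n) (t v : Param d) :
    0 ≤ inner ℝ (empHess loss P t v) v := by
  rw [inner_empHess]
  exact empMean_nonneg P fun z => inner_hess_nonneg (hℓ.contDiff z) (hℓ.convex z) t v

lemma inner_le_of_opNorm_le {H : Param d →L[ℝ] Param d} {c : ℝ} (h : ‖H‖ ≤ c) (v : Param d) :
    inner ℝ (H v) v ≤ c * ‖v‖ ^ 2 := by
  calc inner ℝ (H v) v ≤ ‖H v‖ * ‖v‖ := real_inner_le_norm _ _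
    _ ≤ c * ‖v‖ * ‖v‖ := by gcongr; exact H.le_of_opNorm_le h v
    _ = _ := by ring

lemma inner_empHess_lipschitz (hn : 0 < n) (hℓ : IsSmoothLoss loss L₀ L₁ L₂) (P : Sym Z n)
    (t u v : Param d) :
    inner ℝ (empHess loss P t v) v - L₂ * ‖t - u‖ * ‖v‖ ^ 2 ≤ inner ℝ (empHess loss P u v) v := by
  have h : empMean P (fun z => inner ℝ (hess (fun u => loss u z) t v) v) ≤
      empMean P (fun z => inner ℝ (hess (fun u => loss u z) u v) v + L₂ * ‖t - u‖ * ‖v‖ ^ 2) := by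
    refine empMean_mono P fun z => ?_
    have := inner_le_of_opNorm_le (hℓ.hess_lip z t u) v
    rw [sub_apply, inner_sub_left] at this
    linarith
  rw [empMean_add, empMean_const hn] at h
  rw [inner_empHess, inner_empHess]
  linarith

lemma norm_empGrad_sub_le (hℓ : IsSmoothLoss loss L₀ L₁ L₂) (h : Neighboring P P')
    (t : Param d) : ‖empGrad loss P' t - empGrad loss P t‖ ≤ 2 * L₀ / n := by
  obtain ⟨s, z, z', hP, hP'⟩ := h
  rw [empGrad, empGrad, empMean_sub_empMean hP hP', norm_smul, norm_inv, Real.norm_natCast,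
    inv_mul_eq_div]
  have h1 := norm_sub_le (gradient (fun u => loss u z') t) (gradient (fun u => loss u z) t)
  have h2 := hℓ.grad_le z t
  have h3 := hℓ.grad_le z' t
  gcongr
  linarith

/-- The loss is L₁/n rather than 2L₁/n because the incoming Hessian is positive semidefinite and can
be dropped. -/
lemma inner_empHess_neighbor (hℓ : IsSmoothLoss loss L₀ L₁ L₂) (h : Neighboring P P')
    (t v : Param d) :
    inner ℝ (empHess loss P t v) v - L₁ / n * ‖v‖ ^ 2 ≤ inner ℝ (empHess loss P' t v) v := by
  obtain ⟨s, z, z', hP, hP'⟩ := h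
  have h1 := empMean_sub_empMean hP hP' (fun z => inner ℝ (hess (fun u => loss u z) t v) v)
  rw [← inner_empHess, ← inner_empHess, smul_eq_mul] at h1
  have h2 := inner_le_of_opNorm_le (hℓ.hess_le z t) v
  have h3 := inner_hess_nonneg (hℓ.contDiff z') (hℓ.convex z') t v
  have h4 : (n : ℝ)⁻¹ * (-(L₁ * ‖v‖ ^ 2)) ≤
      (n : ℝ)⁻¹ * (inner ℝ (hess (fun u => loss u z') t v) v -
        inner ℝ (hess (fun u => loss u z) t v) v) := by
    gcongr
    linarith
  have e : L₁ / n * ‖v‖ ^ 2 = -((n : ℝ)⁻¹ * (-(L₁ * ‖v‖ ^ 2))) := by ring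
  rw [e]
  linarith

lemma convexOn_objective (hreg : 0 ≤ reg) (hℓ : IsSmoothLoss loss L₀ L₁ L₂) (P : Sym Z n) :
    ConvexOn ℝ Set.univ (objective loss reg t₀ P) := by
  have h1 : ConvexOn ℝ Set.univ (fun t : Param d => ‖t - t₀‖) := by
    simpa [sub_eq_add_neg, Function.comp_def, add_comm] using
      (convexOn_norm (E := Param d) convex_univ).translate_right (-t₀)
  have h2 := (h1.pow (fun t _ => norm_nonneg (t - t₀)) 2).smul
    (show 0 ≤ reg / 2 by positivity)
  exact (convexOn_empMean P hℓ.convex).add h2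

lemma continuous_objective (hℓ : IsSmoothLoss loss L₀ L₁ L₂) (P : Sym Z n) :
    Continuous (objective loss reg t₀ P) := by
  have h1 := continuous_empMean P fun z => (hℓ.contDiff z).continuous
  have h2 : Continuous fun t : Param d => reg / 2 * ‖t - t₀‖ ^ 2 := by fun_prop
  exact h1.add h2

lemma hasDerivAt_objective_line (hℓ : IsSmoothLoss loss L₀ L₁ L₂) (P : Sym Z n)
    (t v : Param d) :
    HasDerivAt (fun s : ℝ => objective loss reg t₀ P (t + s • v))
      (inner ℝ (empGrad loss P t + reg • (t - t₀)) v) 0 := by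
  have h1 := hasDerivAt_empMean P fun z => hasDerivAt_comp_line (hℓ.contDiff z) t v 0
  have h2 := (((hasDerivAt_line t v 0).sub_const t₀).norm_sq).const_mul (reg / 2)
  have h3 := h1.add h2
  simp only [zero_smul, add_zero] at h3
  rw [← inner_empGrad] at h3
  rw [inner_add_left, real_inner_smul_left]
  exact h3.congr_deriv (by ring)

/-- Growth of the gradient of the objective around a minimizer. -/
lemma inner_gradient_ge (hn : 0 < n) (hℓ : IsSmoothLoss loss L₀ L₁ L₂)
    {P : Sym Z n} {u : Param d} {lam : ℝ}
    (hu : empGrad loss P u + reg • (u - t₀) = 0)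
    (hlam : ∀ v, lam * ‖v‖ ^ 2 ≤ inner ℝ (empHess loss P u v) v) (t : Param d) :
    (lam + reg) * ‖t - u‖ ^ 2 - L₂ / 2 * ‖t - u‖ ^ 3 ≤
      inner ℝ (empGrad loss P t + reg • (t - t₀)) (t - u) := by
  set v := t - u with hv
  set r := ‖v‖ with hr
  -- ψ is the derivative of the objective along the segment minus the claimed lower bound. It
  -- vanishes at 0, and the Lipschitz Hessian makes it nondecreasing.
  set ψ : ℝ → ℝ := fun s => empMean P (fun z =>
    inner ℝ (gradient (fun x => loss x z) (u + s • v)) v) + reg * inner ℝ (u + s • v - t₀) v -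
      ((lam + reg) * r ^ 2 * s - L₂ / 2 * r ^ 3 * s ^ 2) with hψ
  have hder : ∀ s : ℝ, HasDerivAt ψ (inner ℝ (empHess loss P (u + s • v) v) v + reg * r ^ 2 -
      ((lam + reg) * r ^ 2 - L₂ * r ^ 3 * s)) s := by
    intro s
    have h1 := hasDerivAt_empMean P fun z =>
      hasDerivAt_inner_gradient_line (hℓ.contDiff z) u v s
    rw [← inner_empHess] at h1
    have h3 := (((hasDerivAt_line u v s).sub_const t₀).inner ℝ (hasDerivAt_const s v)).const_mul reg
    rw [inner_zero_right, zero_add, real_inner_self_eq_norm_sq] at h3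
    have h4 := ((hasDerivAt_id s).const_mul ((lam + reg) * r ^ 2)).sub
      ((hasDerivAt_pow 2 s).const_mul (L₂ / 2 * r ^ 3))
    refine ((h1.add h3).sub h4).congr_deriv ?_
    push_cast
    ring
  have hmono : MonotoneOn ψ (Set.Icc 0 1) := by
    refine monotoneOn_of_hasDerivWithinAt_nonneg (convex_Icc 0 1)
      (fun s _ => (hder s).continuousAt.continuousWithinAt)
      (fun s _ => (hder s).hasDerivWithinAt) fun s hs => ?_
    rw [interior_Icc] at hs
    have h1 := inner_empHess_lipschitz hn hℓ P u (u + s • v) v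
    have h3 := hlam v
    rw [sub_add_cancel_left, norm_neg, norm_smul, Real.norm_of_nonneg hs.1.le] at h1
    have e : L₂ * (s * ‖v‖) * ‖v‖ ^ 2 = L₂ * r ^ 3 * s := by rw [← hr]; ring
    rw [e] at h1
    linarith
  have h01 := hmono (Set.left_mem_Icc.2 zero_le_one) (Set.right_mem_Icc.2 zero_le_one) zero_le_one
  have e0 : ψ 0 = 0 := by
    simp only [hψ, zero_smul, add_zero]
    rw [← inner_empGrad, ← real_inner_smul_left, ← inner_add_left, hu]
    simp
  have e1 : ψ 1 = inner ℝ (empGrad loss P t + reg • (t - t₀)) v -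
      ((lam + reg) * r ^ 2 - L₂ / 2 * r ^ 3) := by
    simp only [hψ, one_smul]
    rw [show u + v = t by rw [hv]; abel, ← inner_empGrad, ← real_inner_smul_left,
      ← inner_add_left]
    ring
  rw [e0, e1] at h01
  linarith

lemma lamMin_of_hasMinimizer (h : HasMinimizer loss reg t₀ P) :
    lamMin loss reg t₀ θ P = minEigenvalue (empHess loss P (θ P)) := if_pos h

lemma lamMin_nonneg (hd : 0 < d) (hℓ : IsSmoothLoss loss L₀ L₁ L₂) (P : Sym Z n) :
    0 ≤ lamMin loss reg t₀ θ P := by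
  by_cases h : HasMinimizer loss reg t₀ P
  · rw [lamMin_of_hasMinimizer h]
    refine le_minEigenvalue hd (inner_empHess_comm hℓ P _) fun v => ?_
    rw [zero_mul]
    exact inner_empHess_nonneg hℓ P _ v
  · exact (if_neg h).ge

/-- On the sphere of radius 2L₀/reg around `t₀` the outward pull of the regularizer is twice what
the loss gradients can oppose. -/
lemma hasMinimizer_of_reg_pos (hn : 0 < n) (h0 : 0 < L₀) (hreg : 0 < reg)
    (hℓ : IsSmoothLoss loss L₀ L₁ L₂) (P : Sym Z n) : HasMinimizer loss reg t₀ P := by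
  have hr : 0 < 2 * L₀ / reg := by positivity
  refine (exists_isMinOn_of_inner_pos (θ := t₀) (convexOn_objective hreg.le hℓ P)
    (continuous_objective hℓ P) (hasDerivAt_objective_line hℓ P) hr fun t ht => ?_).1
  rw [inner_add_left, real_inner_smul_left, real_inner_self_eq_norm_sq, inner_empGrad]
  have h1 : empMean P (fun _ => -(L₀ * ‖t - t₀‖)) ≤
      empMean P (fun z => inner ℝ (gradient (fun u => loss u z) t) (t - t₀)) := by
    refine empMean_mono P fun z => ?_
    have h3 := neg_abs_le (inner ℝ (gradient (fun u => loss u z) t) (t - t₀))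
    have h4 := abs_real_inner_le_norm (gradient (fun u => loss u z) t) (t - t₀)
    have h5 := mul_le_mul_of_nonneg_right (hℓ.grad_le z t) (norm_nonneg (t - t₀))
    linarith
  rw [empMean_const hn] at h1
  have h3 : reg * ‖t - t₀‖ ^ 2 = 2 * L₀ * ‖t - t₀‖ := by rw [ht]; field_simp
  have h4 : 0 < L₀ * ‖t - t₀‖ := by rw [ht]; positivity
  linarith

/-- Local stability: replacing a single observation keeps a minimizer, which moves by at most
`sensBound`, and the smallest eigenvalue is bounded below by the recursion. -/
lemma stability_of_hasMinimizer (hd : 0 < d) (hn : 0 < n) (h0 : 0 < L₀)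
    (h2 : 0 < L₂) (hreg : 0 ≤ reg) (hℓ : IsSmoothLoss loss L₀ L₁ L₂)
    (hθ : IsMEstimator loss reg t₀ θ) (hN : Neighboring P P') (hP : HasMinimizer loss reg t₀ P)
    (hl : 0 < lamMin loss reg t₀ θ P + reg)
    (hc : 8 * L₀ * L₂ / n ≤ (lamMin loss reg t₀ θ P + reg) ^ 2) :
    ‖θ P' - θ P‖ ≤ sensBound L₀ L₂ n (lamMin loss reg t₀ θ P + reg) ∧
      lamMin loss reg t₀ θ P + reg -
        L₂ * sensBound L₀ L₂ n (lamMin loss reg t₀ θ P + reg) - L₁ / n ≤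
          lamMin loss reg t₀ θ P' + reg := by
  have hlam : ∀ v, lamMin loss reg t₀ θ P * ‖v‖ ^ 2 ≤ inner ℝ (empHess loss P (θ P) v) v := by
    rw [lamMin_of_hasMinimizer hP]
    exact minEigenvalue_mul_le_inner hd (inner_empHess_comm hℓ P _)
  have hgrad := eq_zero_of_isMinOn (hasDerivAt_objective_line hℓ P) (hθ P hP)
  set lam := lamMin loss reg t₀ θ P
  have hW := sensBound_pos hn h0 h2 hl
  have hroot := sensBound_root (n := n) h2 hc
  set W := sensBound L₀ L₂ n (lam + reg)
  -- On the sphere of radius W the inner product is at least (lam + reg)W² − L₂W³/2 − (2L₀/n)W,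
  -- which the root equation turns into L₂W³/2 > 0.
  have hmin := exists_isMinOn_of_inner_pos (θ := θ P) (convexOn_objective (t₀ := t₀) hreg hℓ P')
    (continuous_objective hℓ P') (hasDerivAt_objective_line hℓ P') hW fun t ht => by
      have h3 := inner_gradient_ge hn hℓ hgrad hlam t
      have h4 := norm_empGrad_sub_le hℓ hN t
      have h5 := neg_abs_le (inner ℝ (empGrad loss P' t - empGrad loss P t) (t - θ P))
      have h6 := abs_real_inner_le_norm (empGrad loss P' t - empGrad loss P t) (t - θ P)
      have h7 := mul_le_mul_of_nonneg_right h4 (norm_nonneg (t - θ P))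
      rw [ht] at h3 h6 h7
      rw [inner_sub_left] at h5 h6
      rw [inner_add_left] at h3 ⊢
      have h8 : (lam + reg) * W ^ 2 = L₂ * W ^ 3 + 2 * L₀ / n * W := by
        linear_combination W * hroot
      have h9 : 0 < L₂ * W ^ 3 := by positivity
      linarith
  have hP' : HasMinimizer loss reg t₀ P' := hmin.1
  have hdist := hmin.2 _ (hθ P' hP')
  refine ⟨hdist, ?_⟩
  rw [lamMin_of_hasMinimizer hP']
  have := le_minEigenvalue (c := lam - L₂ * W - L₁ / n) hd (inner_empHess_comm hℓ P' (θ P'))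
    fun v => by
      have h3 := inner_empHess_neighbor hℓ hN (θ P') v
      have h4 := inner_empHess_lipschitz hn hℓ P (θ P) (θ P') v
      rw [norm_sub_rev] at h4
      have h5 : L₂ * ‖θ P' - θ P‖ * ‖v‖ ^ 2 ≤ L₂ * W * ‖v‖ ^ 2 := by gcongr
      have h6 := hlam v
      linarith
  linarith

/-- Without a minimizer `lamMin` is 0 by convention, so `reg` would be positive, and then a
minimizer exists. -/
lemma hasMinimizer_of_pos (hn : 0 < n) (h0 : 0 < L₀)
    (hℓ : IsSmoothLoss loss L₀ L₁ L₂) (hl : 0 < lamMin loss reg t₀ θ P + reg) :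
    HasMinimizer loss reg t₀ P := by
  by_contra h
  rw [lamMin, if_neg h, zero_add] at hl
  exact h (hasMinimizer_of_reg_pos hn h0 hl hℓ P)

lemma recursion_le_of_neighboring (hd : 0 < d) (hn : 0 < n) (h0 : 0 < L₀)
    (h2 : 0 < L₂) (hreg : 0 ≤ reg) (hℓ : IsSmoothLoss loss L₀ L₁ L₂)
    (hθ : IsMEstimator loss reg t₀ θ) (hN : Neighboring P P') :
    recursion L₀ L₁ L₂ reg n (lamMin loss reg t₀ θ P + reg) ≤ lamMin loss reg t₀ θ P' + reg := by
  have hnn := lamMin_nonneg (θ := θ) (reg := reg) (t₀ := t₀) hd hℓ P'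
  by_cases h : 8 * L₀ * L₂ / n ≤ (lamMin loss reg t₀ θ P + reg) ^ 2 ∧
      0 < lamMin loss reg t₀ θ P + reg
  · rw [recursion_eq_sensBound hn h2 h.2 h.1]
    exact max_le (stability_of_hasMinimizer hd hn h0 h2 hreg hℓ hθ hN
      (hasMinimizer_of_pos hn h0 hℓ h.2) h.2 h.1).2 (by linarith)
  · rw [recursion, if_neg h]
    linarith

/-- Neighbouring M-estimates are within the sensitivity bound computed from any lower bound on
the statistic that passes the acceptance test. -/
lemma norm_sub_le_sensBound (hd : 0 < d) (hn : 0 < n) (h0 : 0 < L₀) (h1 : 0 < L₁)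
    (h2 : 0 < L₂) (hreg : 0 ≤ reg) (hℓ : IsSmoothLoss loss L₀ L₁ L₂)
    (hθ : IsMEstimator loss reg t₀ θ) (hN : Neighboring P P') {l : ℝ}
    (hl : LargeEnough L₀ L₁ L₂ n l) (hle : l ≤ lamMin loss reg t₀ θ P + reg) :
    ‖θ P' - θ P‖ ≤ sensBound L₀ L₂ n l := by
  have hl0 := hl.pos hn h1
  have hsq := hl.le_sq hn h0 h1 h2
  have hpos := hl0.trans_le hle
  exact (stability_of_hasMinimizer hd hn h0 h2 hreg hℓ hθ hN
    (hasMinimizer_of_pos hn h0 hℓ hpos) hpos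
    (hsq.trans (pow_le_pow_left₀ hl0.le hle 2))).1.trans (sensBound_anti h0 h2 hl0 hsq hle)

end Stability

/-! ### Privacy -/

/-- Composition of a private discrete query with a mechanism that is private given all answers
of the query outside of an unlikely set. -/
lemma prod_le_of_composition {Ω₁ Ω₂ : Type*} [MeasurableSpace Ω₁] [MeasurableSpace Ω₂]
    {μ : Measure Ω₁} [IsProbabilityMeasure μ] {ν : Measure Ω₂} [IsProbabilityMeasure ν]
    {c c' : Ω₁ → ℕ} (hc : Measurable c) (hc' : Measurable c') {B B' : ℕ → Set Ω₂}
    (hB : ∀ m, MeasurableSet (B m)) (hB' : ∀ m, MeasurableSet (B' m)) {bad : Set ℕ}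
    {a b η η' : ENNReal} (h1 : ∀ A : Set ℕ, μ (c ⁻¹' A) ≤ a * μ (c' ⁻¹' A))
    (h2 : ∀ m ∉ bad, ν (B m) ≤ b * ν (B' m) + η) (h3 : μ (c ⁻¹' bad) ≤ η') :
    μ.prod ν {ω | ω.2 ∈ B (c ω.1)} ≤ a * b * μ.prod ν {ω | ω.2 ∈ B' (c' ω.1)} + (η + η') := by
  have hmeas : ∀ {f : Ω₁ → ℕ} {D : ℕ → Set Ω₂}, Measurable f → (∀ m, MeasurableSet (D m)) →
      MeasurableSet {ω : Ω₁ × Ω₂ | ω.2 ∈ D (f ω.1)} := by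
    intro f D hf hD
    have e : {ω : Ω₁ × Ω₂ | ω.2 ∈ D (f ω.1)} = ⋃ m, (f ⁻¹' {m}) ×ˢ D m := by
      ext ω; simp
    rw [e]
    exact MeasurableSet.iUnion fun m => (hf (measurableSet_singleton m)).prod (hD m)
  rw [Measure.prod_apply (hmeas hc hB), Measure.prod_apply (hmeas hc' hB')]
  have hle : μ.map c ≤ a • μ.map c' := by
    refine Measure.le_iff.2 fun A hA => ?_
    rw [Measure.smul_apply, Measure.map_apply hc hA, Measure.map_apply hc' hA, smul_eq_mul]
    exact h1 A
  have hbad : MeasurableSet (c ⁻¹' bad) := hc (MeasurableSet.of_discrete)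
  calc ∫⁻ x, ν (B (c x)) ∂μ
      ≤ ∫⁻ x, (b * ν (B' (c x)) + η + (c ⁻¹' bad).indicator 1 x) ∂μ := by
        -- On bad answers the probability is bounded by one, paid for by the indicator.
        refine lintegral_mono fun x => ?_
        by_cases hx : c x ∈ bad
        · have : (c ⁻¹' bad).indicator (1 : Ω₁ → ENNReal) x = 1 :=
            Set.indicator_of_mem (show x ∈ c ⁻¹' bad from hx) _
          rw [this]
          exact prob_le_one.trans le_add_self
        · exact (h2 _ hx).trans le_self_add
    _ = b * ∫⁻ x, ν (B' (c x)) ∂μ + η + μ (c ⁻¹' bad) := by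
        rw [lintegral_add_right _ (measurable_one.indicator hbad), lintegral_indicator_one hbad,
          lintegral_add_right _ measurable_const, lintegral_const, measure_univ, mul_one,
          lintegral_const_mul]
        exact (measurable_of_countable fun m => ν (B' m)).comp hc
    _ = b * ∫⁻ m, ν (B' m) ∂(μ.map c) + η + μ (c ⁻¹' bad) := by
        rw [lintegral_map (measurable_of_countable _) hc]
    _ ≤ b * ∫⁻ m, ν (B' m) ∂(a • μ.map c') + η + η' := by
        gcongr
    _ = a * b * ∫⁻ x, ν (B' (c' x)) ∂μ + (η + η') := by
        rw [lintegral_smul_measure, lintegral_map (measurable_of_countable _) hc', smul_eq_mul]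
        ring

/-- The integer part of the noisy count that determines the private lower bound. -/
noncomputable def noisyCount (N : ℕ) (ε δ ξ : ℝ) : ℕ :=
  ⌊((N : ℝ) + 1 / ε * ξ) - cutoff ε δ⌋₊

lemma measurable_noisyCount (N : ℕ) (ε δ : ℝ) : Measurable (noisyCount N ε δ) :=
  Nat.measurable_floor.comp (by fun_prop)

lemma noisyCount_shift {ε : ℝ} (hε : 0 < ε) (N N' : ℕ) (δ ξ : ℝ) :
    noisyCount N ε δ ξ = noisyCount N' ε δ (ξ + ε * ((N : ℝ) - N')) := by
  rw [noisyCount, noisyCount]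
  congr 1
  field_simp
  ring

lemma laplace_noisyCount_le {ε : ℝ} (hε : 0 < ε) {N N' : ℕ} (h : N ≤ N' + 1) (h' : N' ≤ N + 1)
    (δ : ℝ) (A : Set ℕ) :
    laplace (noisyCount N ε δ ⁻¹' A) ≤
      ENNReal.ofReal (Real.exp ε) * laplace (noisyCount N' ε δ ⁻¹' A) := by
  have e : noisyCount N ε δ ⁻¹' A =
      (fun x => x + ε * ((N : ℝ) - N')) ⁻¹' (noisyCount N' ε δ ⁻¹' A) := by
    ext ξ
    simp only [Set.mem_preimage]
    rw [noisyCount_shift hε N N']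
  rw [e]
  refine (laplace_preimage_add_le _ (measurable_noisyCount N' ε δ MeasurableSet.of_discrete)).trans
    ?_
  gcongr
  rw [abs_mul, abs_of_pos hε]
  refine mul_le_of_le_one_right hε.le (abs_le.2 ⟨?_, ?_⟩)
  · have : (N' : ℝ) ≤ N + 1 := by exact_mod_cast h'
    linarith
  · have : (N : ℝ) ≤ N' + 1 := by exact_mod_cast h
    linarith

lemma cutoff_half {ε δ : ℝ} : cutoff (ε / 2) (δ / 2) = 1 / (ε / 2) * Real.log (1 / δ) := by
  rw [cutoff, mul_div_cancel₀ δ two_ne_zero]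

/-- The cutoff at level (ε/2, δ/2) is (2/ε) log(1/δ), exactly the noise at ξ = log(1/δ), a value
reached with probability δ/2. -/
lemma noisyCount_lt {ε δ ξ : ℝ} (hε : 0 < ε) (hξ : ξ < Real.log (1 / δ)) (N : ℕ) :
    noisyCount N (ε / 2) (δ / 2) ξ = 0 ∨ noisyCount N (ε / 2) (δ / 2) ξ < N := by
  rcases Nat.eq_zero_or_pos (noisyCount N (ε / 2) (δ / 2) ξ) with h | h
  · exact Or.inl h
  · right
    have h1 := Nat.floor_le (zero_le_one.trans (Nat.floor_pos.1 h))
    rw [cutoff_half] at h1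
    have h2 : 1 / (ε / 2) * ξ < 1 / (ε / 2) * Real.log (1 / δ) := by gcongr
    have h3 : ((noisyCount N (ε / 2) (δ / 2) ξ : ℕ) : ℝ) < N := by
      unfold noisyCount
      rw [cutoff_half]
      linarith
    exact_mod_cast h3

lemma exp_neg_log_one_div {x : ℝ} (hx : 0 < x) : Real.exp (-Real.log (1 / x)) = x := by
  rw [← Real.log_inv, one_div, inv_inv, Real.exp_log hx]

section Release

variable {Z : Type*} {d n : ℕ} {loss : Param d → Z → ℝ} {L₀ L₁ L₂ reg : ℝ} {t₀ : Param d}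
  {θ : Sym Z n → Param d} {ε δ : ℝ}

open Classical in
/-- The response of the algorithm given the lower bound `l` and the Gaussian noise `g`. -/
noncomputable def respond (L₀ L₁ L₂ : ℝ) (n : ℕ) (σ : ℝ) (t : Param d) (l : ℝ) (g : Param d) :
    Param d ⊕ Unit :=
  if LargeEnough L₀ L₁ L₂ n l then Sum.inl (t + (sensBound L₀ L₂ n l * σ) • g) else Sum.inr ()

lemma release_eq_respond (P : Sym Z n) (ω : ℝ × Param d) :
    release loss L₀ L₁ L₂ reg t₀ θ ε δ P ω =
      respond L₀ L₁ L₂ n √(privVar (ε / 2) (δ / 2)) (θ P)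
        (levelSup (recursion L₀ L₁ L₂ reg n) reg
          (noisyCount (steps (recursion L₀ L₁ L₂ reg n) reg (lamMin loss reg t₀ θ P + reg))
            (ε / 2) (δ / 2) ω.1)) ω.2 := rfl

lemma measurable_respond (σ l : ℝ) (t : Param d) :
    Measurable (respond L₀ L₁ L₂ n σ t l) := by
  by_cases h : LargeEnough L₀ L₁ L₂ n l
  · have e : respond L₀ L₁ L₂ n σ t l =
        fun g => Sum.inl (t + (sensBound L₀ L₂ n l * σ) • g) := funext fun g => if_pos h
    rw [e]
    exact measurable_inl.comp (by fun_prop)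
  · have e : respond L₀ L₁ L₂ n σ t l = fun _ => Sum.inr () := funext fun g => if_neg h
    rw [e]
    exact measurable_const

/-- For a common `l`, changing the centre amounts to shifting the Gaussian by (t − t')/(Wσ), of norm
at most 1/σ. If `l` is rejected, both responses are the same constant. -/
lemma stdGaussian_respond_le {σ : ℝ} (hε : 0 < ε) (hσ : 0 < σ)
    (hδ : gaussianReal 0 1 (Set.Iio (1 / (2 * σ) - σ * ε)) ≤ ENNReal.ofReal δ)
    (hn : 0 < n) (h0 : 0 < L₀) (h1 : 0 < L₁) (h2 : 0 < L₂) {l : ℝ} {t t' : Param d}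
    (h : LargeEnough L₀ L₁ L₂ n l → ‖t' - t‖ ≤ sensBound L₀ L₂ n l)
    {A : Set (Param d ⊕ Unit)} (hA : MeasurableSet A) :
    stdGaussian (Param d) (respond L₀ L₁ L₂ n σ t l ⁻¹' A) ≤
      ENNReal.ofReal (Real.exp ε) * stdGaussian (Param d) (respond L₀ L₁ L₂ n σ t' l ⁻¹' A) +
        ENNReal.ofReal δ := by
  by_cases hl : LargeEnough L₀ L₁ L₂ n l
  · have hW := sensBound_pos hn h0 h2 (hl.pos hn h1)
    set W := sensBound L₀ L₂ n l with hWdef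
    have hs : 0 < W * σ := mul_pos hW hσ
    have hv : ‖(W * σ)⁻¹ • (t - t')‖ * σ ≤ 1 := by
      rw [norm_smul, norm_inv, Real.norm_of_nonneg hs.le, norm_sub_rev]
      calc (W * σ)⁻¹ * ‖t' - t‖ * σ ≤ (W * σ)⁻¹ * W * σ := by gcongr; exact h hl
        _ = 1 := by field_simp
    have key := stdGaussian_shift_le hε hσ hδ hv
      (measurable_respond (L₀ := L₀) (L₁ := L₁) (L₂ := L₂) (n := n) σ l t' hA)
    have e : (fun g => g + (W * σ)⁻¹ • (t - t')) ⁻¹' (respond L₀ L₁ L₂ n σ t' l ⁻¹' A) =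
        respond L₀ L₁ L₂ n σ t l ⁻¹' A := by
      ext g
      simp only [Set.mem_preimage, respond, if_pos hl]
      rw [← hWdef, smul_add, smul_smul, mul_inv_cancel₀ hs.ne', one_smul]
      have : t' + ((W * σ) • g + (t - t')) = t + (W * σ) • g := by abel
      rw [this]
    rwa [e] at key
  · have e : respond L₀ L₁ L₂ n σ t l = respond L₀ L₁ L₂ n σ t' l := by
      funext g; simp [respond, hl]
    rw [e]
    refine le_trans ?_ le_self_add
    refine le_mul_of_one_le_left' ?_
    rw [ENNReal.one_le_ofReal]
    exact Real.one_le_exp hε.le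

theorem isDP_release (hd : 0 < d) (hn : 0 < n) (h0 : 0 < L₀) (h1 : 0 < L₁) (h2 : 0 < L₂)
    (hreg : 0 ≤ reg) (hℓ : IsSmoothLoss loss L₀ L₁ L₂) (hθ : IsMEstimator loss reg t₀ θ)
    (hε : 0 < ε) (hδ : 0 < δ) (hδ1 : δ < 1) :
    IsDP (noiseLaw d) (release loss L₀ L₁ L₂ reg t₀ θ ε δ) ε δ := by
  intro P P' hN A hA
  have hε2 : 0 < ε / 2 := by positivity
  have hδ2 : 0 < δ / 2 := by positivity
  have hσ := sqrt_privVar_pos hε2 hδ2 (by linarith)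
  have hσδ := gaussianReal_Iio_privVar_le hε2 hδ2 (by linarith)
  set σ := √(privVar (ε / 2) (δ / 2)) with hσdef
  set R := recursion L₀ L₁ L₂ reg n with hR
  set lam : Sym Z n → ℝ := fun P => lamMin loss reg t₀ θ P + reg with hlam
  have hlam_ge : ∀ P, reg ≤ lam P := fun P =>
    le_add_of_nonneg_left (lamMin_nonneg hd hℓ P)
  have hsteps : ∀ Q Q', Neighboring Q Q' → steps R reg (lam Q) ≤ steps R reg (lam Q') + 1 :=
    fun Q Q' hQ => steps_le_succ (recursion_mono hn) (recursion_reg hn h0 h1 h2)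
      (fun x => reg_le_recursion x) (exists_iterate_recursion_eq hn h0 h1 h2 (hlam_ge Q'))
      (recursion_le_of_neighboring hd hn h0 h2 hreg hℓ hθ hQ)
  set c : Sym Z n → ℝ → ℕ := fun Q => noisyCount (steps R reg (lam Q)) (ε / 2) (δ / 2) with hc
  set B : Sym Z n → ℕ → Set (Param d) :=
    fun Q m => respond L₀ L₁ L₂ n σ (θ Q) (levelSup R reg m) ⁻¹' A with hB
  have hBm : ∀ Q m, MeasurableSet (B Q m) := fun Q m => measurable_respond σ _ _ hA
  -- Bad counts are those whose level overshoots the true statistic of `P`; only there may W fail to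
  -- bound the sensitivity.
  have hbad : laplace (c P ⁻¹' {m | lam P < levelSup R reg m}) ≤ ENNReal.ofReal (δ / 2) := by
    have hsub : c P ⁻¹' {m | lam P < levelSup R reg m} ⊆ Set.Ici (Real.log (1 / δ)) := by
      intro ξ hξ
      by_contra hlt
      have h3 := noisyCount_lt hε (not_le.1 hlt) (steps R reg (lam P))
      exact absurd (levelSup_le (recursion_mono hn) (recursion_reg hn h0 h1 h2) hreg
        (hlam_ge P) h3) (not_le.2 hξ)
    refine (measure_mono hsub).trans_eq ?_
    rw [laplace_Ici (Real.log_nonneg (by rw [le_div_iff₀ hδ]; linarith)), exp_neg_log_one_div hδ]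
  have key := prod_le_of_composition (ν := stdGaussian (Param d))
    (measurable_noisyCount _ _ _ : Measurable (c P))
    (measurable_noisyCount _ _ _ : Measurable (c P')) (hBm P) (hBm P')
    (laplace_noisyCount_le hε2 (hsteps P P' hN) (hsteps P' P hN.symm) (δ / 2))
    (fun m hm => stdGaussian_respond_le hε2 hσ hσδ hn h0 h1 h2
      (fun hl => norm_sub_le_sensBound hd hn h0 h1 h2 hreg hℓ hθ hN hl (not_lt.1 hm)) hA) hbad
  rw [← ENNReal.ofReal_mul (Real.exp_nonneg _), ← Real.exp_add, add_halves,
    ← ENNReal.ofReal_add hδ2.le hδ2.le, add_halves] at key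
  exact key

/-! ### Accuracy -/

/-- The shortfall is at most 2 log(1/δ)/ε from the noise, the same from the cutoff, and less than
one from rounding. -/
lemma le_noisyCount_add {ξ : ℝ} (hε : 0 < ε) (hξ : -Real.log (1 / δ) ≤ ξ) (N : ℕ)
    (hL : 0 ≤ Real.log (1 / δ)) :
    ∃ j : ℕ, N ≤ noisyCount N (ε / 2) (δ / 2) ξ + j ∧
      (j : ℝ) ≤ 4 * (Real.log (1 / δ) / ε) + 1 := by
  refine ⟨N - noisyCount N (ε / 2) (δ / 2) ξ, by omega, ?_⟩
  set m := noisyCount N (ε / 2) (δ / 2) ξ with hm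
  have h1 : ((N : ℝ) + 1 / (ε / 2) * ξ) - cutoff (ε / 2) (δ / 2) < m + 1 := Nat.lt_floor_add_one _
  rw [cutoff_half] at h1
  have h2 : 1 / (ε / 2) * (-Real.log (1 / δ)) ≤ 1 / (ε / 2) * ξ := by gcongr
  have e : 1 / (ε / 2) * Real.log (1 / δ) = 2 * (Real.log (1 / δ) / ε) := by field_simp
  have h0 : 0 ≤ Real.log (1 / δ) / ε := by positivity
  rcases le_total N m with h | h
  · rw [Nat.sub_eq_zero_of_le h]
    push_cast
    linarith
  · rw [Nat.cast_sub h]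
    linarith

/-- Numerical consequences of the lower bound on the smallest eigenvalue. -/
lemma half_le_iterate_recursion {K C lam l b : ℝ} (hn : 0 < n) (h0 : 0 < L₀) (h1 : 0 < L₁)
    (h2 : 0 < L₂) (hK : 0 < K) (hC : 128 * (1 + K) ≤ C) (hb : 1 ≤ K * b)
    (hC1 : C * (L₁ / n * b) ≤ lam) (hC2 : C * √(L₀ * L₂ / n * b) ≤ lam) (hl : lam ≤ l) {j : ℕ}
    (hj : (j : ℝ) ≤ 4 * b + 1) :
    l / 2 ≤ (recursion L₀ L₁ L₂ reg n)^[j] l ∧ LargeEnough L₀ L₁ L₂ n (l / 2) ∧ 0 < lam := by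
  have hb0 : 0 < b := by by_contra! h; nlinarith
  have hC0 : 128 ≤ C := by linarith
  have hx : 0 < L₁ / n := by positivity
  have hy : 0 < L₀ * L₂ / n := by positivity
  set x := L₁ / n with hxdef
  set y := L₀ * L₂ / n with hydef
  have hxb : 0 < x * b := by positivity
  have hyb : 0 < y * b := by positivity
  have hlam : 0 < lam := lt_of_lt_of_le (by positivity) hC1
  have hl0 : 0 < l := hlam.trans_le hl
  have hsq : C * (C * (y * b)) ≤ l ^ 2 := by
    have := pow_le_pow_left₀ (by positivity) (hC2.trans hl) 2
    rw [mul_pow, Real.sq_sqrt hyb.le] at this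
    linarith
  have hyC : 128 * (C * (y * b)) ≤ l ^ 2 :=
    (mul_le_mul_of_nonneg_right hC0 (by positivity)).trans hsq
  have hyK : 128 * ((1 + K) * (y * b)) ≤ C * (y * b) := by
    nlinarith [mul_le_mul_of_nonneg_right hC hyb.le]
  have hxK : 128 * ((1 + K) * (x * b)) ≤ l := by
    nlinarith [mul_le_mul_of_nonneg_right hC hxb.le]
  have hy1 : y ≤ (1 + K) * (y * b) := by
    nlinarith [mul_le_mul_of_nonneg_left hb hy.le]
  have hx1 : x ≤ (1 + K) * (x * b) := by
    nlinarith [mul_le_mul_of_nonneg_left hb hx.le]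
  -- The rounding term 1 is absorbed through 1 ≤ Kb; here b stands for log(1/δ)/ε.
  have hjK : (j : ℝ) ≤ 4 * ((1 + K) * b) := by nlinarith
  have e8 : 8 * L₀ * L₂ / n = 8 * y := by rw [hydef]; ring
  have hjx : j * x ≤ l / 4 := by
    have := mul_le_mul_of_nonneg_right hjK hx.le
    linarith
  have hjy : j * (8 * y / l) ≤ l / 4 := by
    have h3 := mul_le_mul_of_nonneg_right hjK hy.le
    rw [← mul_div_assoc, div_le_iff₀ hl0]
    nlinarith
  refine ⟨?_, ?_, hlam⟩
  · have hjs : j * (8 * L₀ * L₂ / n / l + L₁ / n) ≤ l / 2 := by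
      rw [e8, ← hxdef]; linarith
    refine le_trans ?_ (sub_mul_le_iterate_recursion hn h0 h1 h2 hl0 ?_ j hjs)
    · linarith
    · rw [e8]; linarith
  · refine max_le ?_ (Real.sqrt_le_iff.2 ⟨by positivity, ?_⟩)
    · rw [mul_div_assoc, ← hxdef]; linarith
    · have e12 : 12 * L₀ * L₂ / n = 12 * y := by rw [hydef]; ring
      rw [e12, div_pow]; linarith

theorem release_accuracy {K γ : ℝ} (hK : 0 < K) (hd : 0 < d) (hn : 0 < n) (h0 : 0 < L₀)
    (h1 : 0 < L₁) (h2 : 0 < L₂) (hreg : 0 ≤ reg) (hℓ : IsSmoothLoss loss L₀ L₁ L₂)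
    (hε : 0 < ε) (hδ : 0 < δ) (hδ1 : δ < 1) (hγ : 0 < γ) (hγ1 : γ < 1)
    (hKL : max 1 ε ≤ K * Real.log (1 / δ)) {C : ℝ}
    (hC : 128 * (1 + K) + 16 * (2 * √(2 + 4 * K) + K) ≤ C) (P : Sym Z n)
    (hP : C * max (L₁ / (n * ε) * Real.log (1 / δ)) √(L₀ * L₂ / (n * ε) * Real.log (1 / δ))
      ≤ lamMin loss reg t₀ θ P) :
    ENNReal.ofReal (1 - δ - γ) ≤
      noiseLaw d {ω | ∃ t : Param d,
        release loss L₀ L₁ L₂ reg t₀ θ ε δ P ω = Sum.inl t ∧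
        ‖θ P - t‖ ≤ C * (L₀ / (n * ε * lamMin loss reg t₀ θ P)) * √(Real.log (1 / δ)) *
          (√d + √(Real.log (1 / γ)))} := by
  have hKL1 := (le_max_left _ _).trans hKL
  have hKL2 := (le_max_right _ _).trans hKL
  set L := Real.log (1 / δ) with hL
  have hL0 : 0 < L := by by_contra! h; nlinarith
  have hnn := lamMin_nonneg (θ := θ) (reg := reg) (t₀ := t₀) hd hℓ P
  set lam := lamMin loss reg t₀ θ P with hlam
  set S := 2 * √(2 + 4 * K) + K with hS
  have hS0 : 0 < S := by positivity
  have hC0 : 0 < C := by linarith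
  have hC1 : C * (L₁ / n * (L / ε)) ≤ lam := by
    refine le_trans ?_ hP
    gcongr
    refine le_max_of_le_left (le_of_eq ?_)
    field_simp
  have hC2 : C * √(L₀ * L₂ / n * (L / ε)) ≤ lam := by
    refine le_trans ?_ hP
    gcongr
    refine le_max_of_le_right (le_of_eq ?_)
    congr 1
    field_simp
  have hb : 1 ≤ K * (L / ε) := by
    rw [← mul_div_assoc, le_div_iff₀ hε]; linarith
  have hσ := sqrt_privVar_half_le hK hε hδ hKL1 hKL2
  have hbad1 : noiseLaw d (Set.Iio (-L) ×ˢ Set.univ) ≤ ENNReal.ofReal δ := by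
    rw [noiseLaw, Measure.prod_prod, measure_univ, mul_one, laplace_Iio (by linarith), hL,
      exp_neg_log_one_div hδ]
    exact ENNReal.ofReal_le_ofReal (by linarith)
  have hbad2 : noiseLaw d (Set.univ ×ˢ {g : Param d | 2 * (√d + √(Real.log (1 / γ))) < ‖g‖}) ≤
      ENNReal.ofReal γ := by
    rw [noiseLaw, Measure.prod_prod, measure_univ, one_mul]
    simpa using stdGaussian_norm_tail (ι := Fin d) hγ hγ1
  set good := {ω : ℝ × Param d | ∃ t : Param d,
        release loss L₀ L₁ L₂ reg t₀ θ ε δ P ω = Sum.inl t ∧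
        ‖θ P - t‖ ≤ C * (L₀ / (n * ε * lam)) * √L * (√d + √(Real.log (1 / γ)))} with hgood
  -- Covering the whole space and using subadditivity avoids the measurability of `good`.
  have hcover : (Set.univ : Set (ℝ × Param d)) ⊆ good ∪ (Set.Iio (-L) ×ˢ Set.univ ∪
      Set.univ ×ˢ {g : Param d | 2 * (√d + √(Real.log (1 / γ))) < ‖g‖}) := by
    rintro ⟨ξ, g⟩ -
    by_contra hω
    simp only [Set.mem_union, Set.mem_prod, Set.mem_Iio, Set.mem_univ, and_true, true_and,
      Set.mem_ofPred_eq, not_or, not_lt] at hω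
    obtain ⟨hng, hξ, hg⟩ := hω
    refine hng ?_
    rw [hgood, Set.mem_ofPred_eq, release_eq_respond]
    obtain ⟨j, hj, hj'⟩ := le_noisyCount_add hε hξ
      (steps (recursion L₀ L₁ L₂ reg n) reg (lam + reg)) hL0.le
    obtain ⟨hit, hlarge, hlam0⟩ := half_le_iterate_recursion (reg := reg) (l := lam + reg) hn h0
      h1 h2 hK (by linarith) hb hC1 hC2 (by linarith) hj'
    have hle := hit.trans (le_levelSup_recursion hn h0 h1 h2 hreg (by linarith) hj)
    rw [← hlam]
    set l := levelSup (recursion L₀ L₁ L₂ reg n) reg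
      (noisyCount (steps (recursion L₀ L₁ L₂ reg n) reg (lam + reg)) (ε / 2) (δ / 2) ξ)
    have hlarge' : LargeEnough L₀ L₁ L₂ n l := le_trans hlarge hle
    have hl0 := hlarge'.pos hn h1
    have hW0 := sensBound_pos (L₀ := L₀) (L₂ := L₂) (n := n) hn h0 h2 hl0
    have hW : sensBound L₀ L₂ n l ≤ 8 * (L₀ / (n * lam)) := by
      refine (sensBound_le hn h0 h2 hl0 (hlarge'.le_sq hn h0 h1 h2)).trans ?_
      have e : 8 * (L₀ / (n * lam)) = 4 * L₀ / (n * (lam / 2)) := by field_simp; norm_num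
      rw [e]
      gcongr
      linarith
    refine ⟨_, if_pos hlarge', ?_⟩
    rw [sub_add_cancel_left, norm_neg, norm_smul,
      Real.norm_of_nonneg (mul_nonneg hW0.le (Real.sqrt_nonneg _))]
    -- The constant 16S is 8 from W at λ̂ ≥ lam/2, times S from the standard deviation, times 2 from
    -- the norm tail.
    calc sensBound L₀ L₂ n l * √(privVar (ε / 2) (δ / 2)) * ‖g‖
        ≤ 8 * (L₀ / (n * lam)) * (S * (√L / ε)) * (2 * (√d + √(Real.log (1 / γ)))) := by
          gcongr
      _ = 16 * S * (L₀ / (n * ε * lam)) * √L * (√d + √(Real.log (1 / γ))) := by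
          field_simp; ring
      _ ≤ C * (L₀ / (n * ε * lam)) * √L * (√d + √(Real.log (1 / γ))) := by
          gcongr
          linarith
  have hprob : IsProbabilityMeasure (noiseLaw d) := by unfold noiseLaw; infer_instance
  rw [sub_sub, ENNReal.ofReal_sub _ (by positivity), ENNReal.ofReal_one, tsub_le_iff_right,
    ENNReal.ofReal_add hδ.le hγ.le]
  calc (1 : ENNReal) = noiseLaw d Set.univ := measure_univ.symm
    _ ≤ noiseLaw d good + (ENNReal.ofReal δ + ENNReal.ofReal γ) :=
      (measure_mono hcover).trans ((measure_union_le _ _).trans (add_le_add le_rfl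
        ((measure_union_le _ _).trans (add_le_add hbad1 hbad2))))

end Release

end ParamRelease

open ParamRelease in
theorem mainTheorem9 :
    -- privacy
    (∀ {Z : Type*} (d n : ℕ), 0 < d → 0 < n →
      ∀ (loss : Param d → Z → ℝ) (L₀ L₁ L₂ reg : ℝ) (t₀ : Param d) (θ : Sym Z n → Param d),
      0 < L₀ → 0 < L₁ → 0 < L₂ → 0 ≤ reg →
      IsSmoothLoss loss L₀ L₁ L₂ → IsMEstimator loss reg t₀ θ →
      ∀ ε δ : ℝ, 0 < ε → 0 < δ → δ < 1 →
        IsDP (noiseLaw d) (release loss L₀ L₁ L₂ reg t₀ θ ε δ) ε δ) ∧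
    -- accuracy
    (∀ K : ℝ, 0 < K → ∃ C : ℝ, 0 < C ∧
      ∀ {Z : Type*} (d n : ℕ), 0 < d → 0 < n →
      ∀ (loss : Param d → Z → ℝ) (L₀ L₁ L₂ reg : ℝ) (t₀ : Param d) (θ : Sym Z n → Param d),
      0 < L₀ → 0 < L₁ → 0 < L₂ → 0 ≤ reg →
      IsSmoothLoss loss L₀ L₁ L₂ → IsMEstimator loss reg t₀ θ →
      ∀ ε δ γ : ℝ, 0 < ε → 0 < δ → δ < 1 → 0 < γ → γ < 1 →
        max 1 ε ≤ K * Real.log (1 / δ) →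
        ∀ P : Sym Z n,
          C * max (L₁ / (n * ε) * Real.log (1 / δ)) √(L₀ * L₂ / (n * ε) * Real.log (1 / δ))
            ≤ lamMin loss reg t₀ θ P →
          ENNReal.ofReal (1 - δ - γ) ≤
            noiseLaw d {ω | ∃ t : Param d,
              release loss L₀ L₁ L₂ reg t₀ θ ε δ P ω = Sum.inl t ∧
              ‖θ P - t‖ ≤ C * (L₀ / (n * ε * lamMin loss reg t₀ θ P)) * √(Real.log (1 / δ)) *
                (√d + √(Real.log (1 / γ)))}) := by
  refine ⟨?_, ?_⟩
  · intro Z d n hd hn loss L₀ L₁ L₂ reg t₀ θ h0 h1 h2 hreg hℓ hθ ε δ hε hδ hδ1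
    exact isDP_release hd hn h0 h1 h2 hreg hℓ hθ hε hδ hδ1
  · intro K hK
    -- The first summand keeps λ̂ above half the statistic and passes the acceptance test; the
    -- second is the constant of the error bound.
    refine ⟨128 * (1 + K) + 16 * (2 * √(2 + 4 * K) + K), by positivity, ?_⟩
    intro Z d n hd hn loss L₀ L₁ L₂ reg t₀ θ h0 h1 h2 hreg hℓ _ ε δ γ hε hδ hδ1 hγ hγ1 hKL P hP
    exact release_accuracy hK hd hn h0 h1 h2 hreg hℓ hε hδ hδ1 hγ hγ1 hKL le_rfl P hP
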